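/- Let $g\ge 2$ and let $f_1,\dots,f_g\in\mathbb{C}[x_0,\dots,x_g]$ be a regular sequence. Let $Y=\operatorname{Spec}\mathbb{C}[x_0,\dots,x_g]/(f_1,\dots,f_g)\subset\mathbb{C}^{g+1}$ be the complete intersection curve it defines, and suppose that the singular locus of $Y$ is $\operatorname{Sing}(Y)=\{0\}$, where $0$ is the origin of $\mathbb{C}^{g+1}$. For $\lambda=(\lambda_2,\dots,\lambda_g)\in(\mathbb{C}\setminus\{0\})^{g-1}$ let $S(\lambda_2,\dots,\lambda_g)\subset\mathbb{C}^{g+1}$ be the closed subscheme defined by the $g-1$ equations $$f_1+\lambda_2f_2=0,\quad f_2+\lambda_3f_3=0,\quad\dots,\quad f_{g-1}+\lambda_gf_g=0.$$ Then for generic $\lambda$, i.e. for all $\lambda$ in the non-empty complement of some Zariski closed subset of $(\mathbb{C}\setminus\{0\})^{g-1}$, the scheme $S(\lambda_2,\dots,\lambda_g)$ is a surface (a reduced separated scheme of finite type over $\mathbb{C}$ of dimension two, not necessarily irreducible) that is equidimensional (every irreducible component has dimension two), normal (all its local rings are integrally closed domains), and smooth over $\mathbb{C}$ at every point other than the origin.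 -/

import Mathlib

noncomputable section

open AlgebraicGeometry CategoryTheory

namespace GenericSurface

/-- The closed subscheme `V(I) = Spec ℂ[x₀, …, x_{m-1}] / I` of affine space `ℂᵐ`. -/
abbrev affineSubscheme {m : ℕ} (I : Ideal (MvPolynomial (Fin m) ℂ)) : Scheme.{0} :=
  Spec (CommRingCat.of (MvPolynomial (Fin m) ℂ ⧸ I))

/-- The structure morphism `V(I) ⟶ Spec ℂ`. -/
abbrev structureMap {m : ℕ} (I : Ideal (MvPolynomial (Fin m) ℂ)) :
    affineSubscheme I ⟶ Spec (CommRingCat.of ℂ) :=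
  Spec.map (CommRingCat.ofHom (algebraMap ℂ (MvPolynomial (Fin m) ℂ ⧸ I)))

/-- The closed immersion of `V(I)` into the affine space `ℂᵐ = Spec ℂ[x₀, …, x_{m-1}]`. -/
abbrev inclusion {m : ℕ} (I : Ideal (MvPolynomial (Fin m) ℂ)) :
    affineSubscheme I ⟶ Spec (CommRingCat.of (MvPolynomial (Fin m) ℂ)) :=
  Spec.map (CommRingCat.ofHom (Ideal.Quotient.mk I))

instance locallyOfFinitePresentation_structureMap {m : ℕ}
    (I : Ideal (MvPolynomial (Fin m) ℂ)) :
    LocallyOfFinitePresentation (structureMap I) := by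
  rw [HasRingHomProperty.Spec_iff (P := @LocallyOfFinitePresentation)]
  simp only [CommRingCat.hom_ofHom]
  rw [RingHom.finitePresentation_algebraMap]
  exact Algebra.FinitePresentation.of_finiteType.mp inferInstance

/-- The origin of `ℂᵐ`, as the closed point of `Spec ℂ[x₀, …, x_{m-1}]` given by the maximal
ideal of polynomials that vanish at `0`. -/
def origin (m : ℕ) : Spec (CommRingCat.of (MvPolynomial (Fin m) ℂ)) :=
  MvPolynomial.pointToPoint (0 : Fin m → ℂ)

/-- The singular locus of `V(I)` (the points at which `V(I)` is not smooth over `ℂ`), seen as a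
set of points of the ambient affine space. -/
def singularLocus {m : ℕ} (I : Ideal (MvPolynomial (Fin m) ℂ)) :
    Set (Spec (CommRingCat.of (MvPolynomial (Fin m) ℂ))) :=
  inclusion I '' {x | x ∉ (structureMap I).smoothLocus}

/-- A complex surface: a variety (a reduced separated scheme of finite type over `ℂ`, not
necessarily irreducible) of dimension two. -/
structure IsComplexSurface {X : Scheme.{0}} (π : X ⟶ Spec (CommRingCat.of ℂ)) : Prop where
  reduced : IsReduced X
  separated : IsSeparated π
  locallyOfFiniteType : LocallyOfFiniteType π
  quasiCompact : QuasiCompact π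
  dim_eq_two : topologicalKrullDim X = 2

/-- Every irreducible component of `X` has dimension `d`. -/
def IsEquidimensional (X : Scheme.{0}) (d : ℕ) : Prop :=
  ∀ Z ∈ irreducibleComponents X, topologicalKrullDim Z = d

/-- A scheme is normal if all its local rings are integrally closed domains. -/
def IsNormalScheme (X : Scheme.{0}) : Prop :=
  ∀ x : X, IsDomain (X.presheaf.stalk x) ∧ IsIntegrallyClosed (X.presheaf.stalk x)

/-- The ideal of the embedding surface `S(λ₂, …, λ_g)`, generated by `f_i + λ_{i+1} f_{i+1}` for
`1 ≤ i ≤ g - 1`. Indices start at zero: `f i` is `f_{i+1}` and `lam i` is `λ_{i+2}`. -/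
def surfaceIdeal {g m : ℕ} (f : Fin g → MvPolynomial (Fin m) ℂ) (lam : Fin (g - 1) → ℂ) :
    Ideal (MvPolynomial (Fin m) ℂ) :=
  Ideal.span (Set.range fun i : Fin (g - 1) =>
    f ⟨i, by omega⟩ + MvPolynomial.C (lam i) * f ⟨i + 1, by omega⟩)

/-- `P` holds for generic points of the torus `(ℂ \ {0})ᵏ`: for all points outside some
Zariski closed subset of the torus whose complement in the torus is non-empty. -/
def ForGenericTorusPoint (k : ℕ) (P : (Fin k → ℂ) → Prop) : Prop :=
  ∃ J : Ideal (MvPolynomial (Fin k) ℂ),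
    (∃ lam : Fin k → ℂ, (∀ i, lam i ≠ 0) ∧ lam ∉ MvPolynomial.zeroLocus ℂ J) ∧
    ∀ lam : Fin k → ℂ, (∀ i, lam i ≠ 0) → lam ∉ MvPolynomial.zeroLocus ℂ J → P lam

end GenericSurface

end

open AlgebraicGeometry CategoryTheory

namespace GenericSurface

section PuncturedSpectrum

variable {A : Type*} [CommRing A]

lemma mem_span_pow_of_mul_mem_span_pow {a b : A} (ha : a ∈ nonZeroDivisors A)
    (hb : ∀ x, b * x ∈ Ideal.span {a} → x ∈ Ideal.span {a}) (n : ℕ) {x : A}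
    (hx : b * x ∈ Ideal.span {a ^ n}) : x ∈ Ideal.span {a ^ n} := by
  induction n generalizing x with
  | zero => simp
  | succ n ih =>
    obtain ⟨y, hy⟩ := Ideal.mem_span_singleton.mp hx
    obtain ⟨x', rfl⟩ := Ideal.mem_span_singleton.mp
      (hb x (Ideal.mem_span_singleton.mpr ⟨a ^ n * y, by rw [hy]; ring⟩))
    have h : b * x' = a ^ n * y := by
      refine (mul_cancel_left_mem_nonZeroDivisors ha).mp ?_
      linear_combination hy
    obtain ⟨z, rfl⟩ := Ideal.mem_span_singleton.mp
      (ih (Ideal.mem_span_singleton.mpr ⟨y, h⟩))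
    exact Ideal.mem_span_singleton.mpr ⟨z, by ring⟩

lemma mem_span_pow_of_pow_mul_mem_span_pow {a b : A} (ha : a ∈ nonZeroDivisors A)
    (hb : ∀ x, b * x ∈ Ideal.span {a} → x ∈ Ideal.span {a}) (n k : ℕ) {x : A}
    (hx : b ^ k * x ∈ Ideal.span {a ^ n}) : x ∈ Ideal.span {a ^ n} := by
  induction k generalizing x with
  | zero => simpa using hx
  | succ k ih =>
    refine mem_span_pow_of_mul_mem_span_pow ha hb n (ih ?_)
    rwa [← mul_assoc, ← pow_succ]

lemma exists_notMem_mul_eq_zero_or {p : Ideal A} [p.IsPrime]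
    [IsDomain (Localization.AtPrime p)] {x y : A} (hxy : x * y = 0) :
    (∃ c ∉ p, c * x = 0) ∨ (∃ c ∉ p, c * y = 0) := by
  have key : ∀ z : A, algebraMap A (Localization.AtPrime p) z = 0 → ∃ c ∉ p, c * z = 0 := by
    intro z hz
    obtain ⟨c, hc⟩ := (IsLocalization.map_eq_zero_iff p.primeCompl _ z).mp hz
    exact ⟨c, c.2, hc⟩
  have h : algebraMap A (Localization.AtPrime p) x * algebraMap A (Localization.AtPrime p) y = 0 := by
    rw [← map_mul, hxy, map_zero]
  rcases mul_eq_zero.mp h with h | h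
  · exact .inl (key x h)
  · exact .inr (key y h)

lemma exists_notMem_mul_mem_span_of_isIntegral [IsDomain A] {p : Ideal A} [p.IsPrime]
    (B : Type*) [CommRing B] [IsDomain B] [Algebra A B] [IsLocalization.AtPrime B p]
    [IsIntegrallyClosed B] {u s : A} (hs : s ∈ nonZeroDivisors A)
    (hx : IsIntegral A (algebraMap A (FractionRing A) u / algebraMap A (FractionRing A) s)) :
    ∃ c ∉ p, c * u ∈ Ideal.span {s} := by
  have hinj : Function.Injective (algebraMap A (FractionRing B)) := by
    rw [IsScalarTower.algebraMap_eq A B (FractionRing B)]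
    exact (IsFractionRing.injective B (FractionRing B)).comp
      (IsLocalization.injective B p.primeCompl_le_nonZeroDivisors)
  let φ : FractionRing A →ₐ[A] FractionRing B :=
    IsFractionRing.liftAlgHom (g := Algebra.ofId A _) hinj
  obtain ⟨y, hy⟩ := (isIntegrallyClosed_iff (FractionRing B)).mp inferInstance
    ((hx.map φ).tower_top (A := B))
  obtain ⟨r, c, rfl⟩ := IsLocalization.exists_mk'_eq p.primeCompl y
  have hs0 : algebraMap A (FractionRing B) s ≠ 0 := fun h0 =>
    nonZeroDivisors.ne_zero hs (hinj (by rw [h0, map_zero]))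
  refine ⟨c, c.2, Ideal.mem_span_singleton.mpr ⟨r, hinj ?_⟩⟩
  rw [map_div₀, AlgHom.commutes, AlgHom.commutes, eq_div_iff hs0] at hy
  have h1 : algebraMap B (FractionRing B) (IsLocalization.mk' B r c) *
      algebraMap A (FractionRing B) c = algebraMap A (FractionRing B) r := by
    rw [IsScalarTower.algebraMap_apply A B (FractionRing B) c, ← map_mul,
      IsLocalization.mk'_spec, ← IsScalarTower.algebraMap_apply]
  rw [map_mul, map_mul, ← hy, ← h1]
  ring

variable [IsLocalRing A]

open IsLocalRing

lemma exists_pow_mem_of_forall_not_le {a : A} (ha : a ∈ maximalIdeal A) (I : Ideal A)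
    (hI : ∀ p : Ideal A, p.IsPrime → p ≠ maximalIdeal A → ¬ I ≤ p) : ∃ n : ℕ, a ^ n ∈ I := by
  change a ∈ I.radical
  rw [Ideal.radical_eq_sInf]
  refine Ideal.mem_sInf.mpr ?_
  rintro p ⟨hp, hpp⟩
  by_cases h : p = maximalIdeal A
  · exact h ▸ ha
  · exact absurd hp (hI p hpp h)

/-- An element that is divisible by a nonzerodivisor at all points of the punctured spectrum
of a local ring of depth at least two is divisible by it. -/
lemma mem_span_of_forall_exists {a b : A} (ham : a ∈ maximalIdeal A) (hbm : b ∈ maximalIdeal A)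
    (ha : a ∈ nonZeroDivisors A) (hb : ∀ x, b * x ∈ Ideal.span {a} → x ∈ Ideal.span {a})
    {s u : A} (hs : s ∈ nonZeroDivisors A)
    (h : ∀ p : Ideal A, p.IsPrime → p ≠ maximalIdeal A → ∃ c ∉ p, c * u ∈ Ideal.span {s}) :
    u ∈ Ideal.span {s} := by
  let I : Ideal A := Submodule.comap (LinearMap.mulRight A u) (Ideal.span {s})
  have hI : ∀ p : Ideal A, p.IsPrime → p ≠ maximalIdeal A → ¬ I ≤ p := by
    intro p hp hpm hle
    obtain ⟨c, hc, hcu⟩ := h p hp hpm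
    exact hc (hle hcu)
  obtain ⟨n, hn⟩ := exists_pow_mem_of_forall_not_le ham I hI
  obtain ⟨k, hk⟩ := exists_pow_mem_of_forall_not_le hbm I hI
  obtain ⟨v, hv⟩ := Ideal.mem_span_singleton.mp (show a ^ n * u ∈ Ideal.span {s} from hn)
  obtain ⟨w, hw⟩ := Ideal.mem_span_singleton.mp (show b ^ k * u ∈ Ideal.span {s} from hk)
  have h1 : b ^ k * v = a ^ n * w := by
    refine (mul_cancel_left_mem_nonZeroDivisors hs).mp ?_
    linear_combination a ^ n * hw - b ^ k * hv
  obtain ⟨v', rfl⟩ := Ideal.mem_span_singleton.mp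
    (mem_span_pow_of_pow_mul_mem_span_pow ha hb n k (Ideal.mem_span_singleton.mpr ⟨w, h1⟩))
  refine Ideal.mem_span_singleton.mpr ⟨v', ?_⟩
  refine (mul_cancel_left_mem_nonZeroDivisors (pow_mem ha n)).mp ?_
  linear_combination hv

lemma isDomain_of_punctured_isDomain [IsNoetherianRing A] {a b : A} (ham : a ∈ maximalIdeal A)
    (hbm : b ∈ maximalIdeal A)
    (ha : a ∈ nonZeroDivisors A) (hb : ∀ x, b * x ∈ Ideal.span {a} → x ∈ Ideal.span {a})
    (h : ∀ p : Ideal A, [p.IsPrime] → p ≠ maximalIdeal A → IsDomain (Localization.AtPrime p)) :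
    IsDomain A := by
  have : NoZeroDivisors A := by
    refine ⟨fun {z w} hzw => ?_⟩
    let I : Ideal A := Submodule.comap (LinearMap.mulRight A z) ⊥
    have hIz : ∀ i ∈ I, i * z = 0 := fun i hi => hi
    have hJ : ∀ p : Ideal A, p.IsPrime → p ≠ maximalIdeal A →
        ¬ I ⊔ Module.annihilator A I ≤ p := by
      intro p hp hpm hle
      have := h p hpm
      have hIp : I ≤ p := le_sup_left.trans hle
      have hmem : (⟨p, hp⟩ : PrimeSpectrum A) ∈ Module.support A I :=
        Module.mem_support_iff_of_finite.mpr (le_sup_right.trans hle)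
      obtain ⟨i, hi⟩ := Module.mem_support_iff_exists_annihilator.mp hmem
      rcases exists_notMem_mul_eq_zero_or (p := p) (hIz i i.2) with ⟨c, hc, hci⟩ | ⟨c, hc, hcz⟩
      · exact hc (hi ((Submodule.mem_annihilator_span_singleton _ _).mpr (Subtype.ext hci)))
      · exact hc (hIp hcz)
    obtain ⟨n, hn⟩ := exists_pow_mem_of_forall_not_le ham _ hJ
    obtain ⟨u, hu, v, hv, huv⟩ := Submodule.mem_sup.mp hn
    have huv0 : u * v = 0 := by
      have := Subtype.ext_iff.mp (Module.mem_annihilator.mp hv ⟨u, hu⟩)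
      simpa [mul_comm] using this
    have hs : a ^ n ∈ nonZeroDivisors A := pow_mem ha n
    obtain ⟨e, he⟩ := Ideal.mem_span_singleton.mp <|
      mem_span_of_forall_exists ham hbm ha hb hs (u := u) (by
        intro p hp hpm
        have := h p hpm
        rcases exists_notMem_mul_eq_zero_or (p := p) huv0 with ⟨c, hc, hcu⟩ | ⟨c, hc, hcv⟩
        · exact ⟨c, hc, by rw [hcu]; exact zero_mem _⟩
        · exact ⟨c, hc, Ideal.mem_span_singleton.mpr ⟨c, by rw [← huv]; linear_combination -hcv⟩⟩)
    have hee : e * (1 - e) = 0 := by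
      refine (mul_left_mem_nonZeroDivisors_eq_zero_iff (mul_mem hs hs)).mp ?_
      have hv' : v = a ^ n * (1 - e) := by linear_combination huv - he
      rw [he, hv'] at huv0
      linear_combination huv0
    rcases isUnit_or_isUnit_of_add_one (show e + (1 - e) = 1 by ring) with hu1 | hu1
    · have h1 : 1 - e = 0 := hu1.mul_right_eq_zero.mp hee
      left
      have : u = a ^ n := by linear_combination he - a ^ n * h1
      exact (mul_left_mem_nonZeroDivisors_eq_zero_iff hs).mp (this ▸ hIz u hu)
    · have h1 : e = 0 := hu1.mul_left_eq_zero.mp hee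
      right
      have : v = a ^ n := by rw [← huv, he, h1]; ring
      have hw : w ∈ I := show w * z = 0 by rw [mul_comm]; exact hzw
      have := Subtype.ext_iff.mp (Module.mem_annihilator.mp (this ▸ hv) ⟨w, hw⟩)
      exact (mul_left_mem_nonZeroDivisors_eq_zero_iff hs).mp (by simpa using this)
  exact NoZeroDivisors.to_isDomain A

/-- A special case of Serre's criterion: a Noetherian local ring of depth at least two whose
punctured spectrum is normal is a normal domain. -/
theorem isDomain_and_isIntegrallyClosed_of_punctured [IsNoetherianRing A] {a b : A}
    (ham : a ∈ maximalIdeal A) (hbm : b ∈ maximalIdeal A)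
    (ha : a ∈ nonZeroDivisors A) (hb : ∀ x, b * x ∈ Ideal.span {a} → x ∈ Ideal.span {a})
    (h : ∀ p : Ideal A, [p.IsPrime] → p ≠ maximalIdeal A →
      IsDomain (Localization.AtPrime p) ∧ IsIntegrallyClosed (Localization.AtPrime p)) :
    IsDomain A ∧ IsIntegrallyClosed A := by
  have : IsDomain A := isDomain_of_punctured_isDomain ham hbm ha hb fun p _ hp => (h p hp).1
  refine ⟨this, (isIntegrallyClosed_iff (FractionRing A)).mpr fun {x} hx => ?_⟩
  obtain ⟨u, s, hs, rfl⟩ := IsFractionRing.div_surjective (A := A) x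
  obtain ⟨y, hy⟩ := Ideal.mem_span_singleton.mp <|
    mem_span_of_forall_exists ham hbm ha hb hs (u := u) (by
      intro p hp hpm
      obtain ⟨_, _⟩ := h p hpm
      exact exists_notMem_mul_mem_span_of_isIntegral (Localization.AtPrime p) hs hx)
  have hs0 : algebraMap A (FractionRing A) s ≠ 0 := fun h0 =>
    nonZeroDivisors.ne_zero hs (IsFractionRing.injective A (FractionRing A) (by rw [h0, map_zero]))
  exact ⟨y, by rw [hy, map_mul, mul_div_cancel_left₀ _ hs0]⟩

end PuncturedSpectrum

open TensorProduct

section Normality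

/-- A finite étale algebra over a field all of whose idempotents are trivial is a field. -/
lemma isField_of_formallyEtale_of_isIdempotentElem {K M : Type*} [Field K] [CommRing M]
    [Nontrivial M] [Algebra K M] [Algebra.EssFiniteType K M] [Algebra.FormallyEtale K M]
    (h : ∀ e : M, e * e = e → e = 0 ∨ e = 1) : IsField M := by
  classical
  obtain ⟨I, _, F, _, _, e, -⟩ := (Algebra.FormallyEtale.iff_exists_algEquiv_prod K M).mp ‹_›
  have : Nontrivial (∀ i, F i) := e.injective.nontrivial
  have hne : Nonempty I := by
    by_contra hI
    rw [not_nonempty_iff] at hI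
    exact not_subsingleton (∀ i, F i) inferInstance
  obtain ⟨i₀⟩ := hne
  have hsub : ∀ i, i = i₀ := by
    intro i
    rcases h (e.symm (Pi.single i₀ 1)) (by rw [← map_mul, ← Pi.single_mul, one_mul]) with h | h
    · rw [map_eq_zero_iff _ e.symm.injective, Pi.single_eq_zero_iff] at h
      exact absurd h one_ne_zero
    · rw [map_eq_one_iff _ e.symm.injective] at h
      by_contra hi
      have := congrFun h i
      rw [Pi.single_eq_of_ne hi, Pi.one_apply] at this
      exact zero_ne_one this
  let _ : Unique I := ⟨⟨i₀⟩, hsub⟩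
  exact (e.toRingEquiv.trans (RingEquiv.piUnique F)).toMulEquiv.isField (Field.toIsField _)

/-- The local rings of an étale algebra over a normal domain are normal domains. -/
theorem isDomain_and_isIntegrallyClosed_of_etale (Q : Type*) {B : Type*} [CommRing Q] [IsDomain Q]
    [IsIntegrallyClosed Q] [CommRing B] [Algebra Q B] [Algebra.Etale Q B] (p : Ideal B)
    [p.IsPrime] :
    IsDomain (Localization.AtPrime p) ∧ IsIntegrallyClosed (Localization.AtPrime p) := by
  let K := FractionRing Q
  let C := Localization.AtPrime p
  have hbij : Function.Bijective (TensorProduct.toIntegralClosure Q C K) :=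
    TensorProduct.toIntegralClosure_bijective_of_tower (S := B)
      TensorProduct.toIntegralClosure_bijective_of_smooth
      (TensorProduct.toIntegralClosure_bijective_of_isLocalization p.primeCompl)
  have : Algebra.FormallyEtale B C := .of_isLocalization p.primeCompl
  have : Algebra.FormallyEtale Q C := .comp Q B C
  have : Algebra.EssFiniteType B C := .of_isLocalization _ p.primeCompl
  have : Algebra.EssFiniteType Q C := .comp _ B _
  have : Module.Flat B C := IsLocalization.flat _ p.primeCompl
  have : Module.Flat Q C := .trans Q B C
  have hmem : ∀ x : C ⊗[Q] K, IsIntegral C x → ∃ c : C, c ⊗ₜ[Q] (1 : K) = x := by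
    intro x hx
    obtain ⟨y, hy⟩ := hbij.2 ⟨x, hx⟩
    have hx' : x = (TensorProduct.toIntegralClosure Q C K y : C ⊗[Q] K) := by rw [hy]
    rw [hx']
    clear hx' hy hx
    induction y with
    | zero => exact ⟨0, by simp⟩
    | add y z hy hz =>
      obtain ⟨c, hc⟩ := hy
      obtain ⟨d, hd⟩ := hz
      exact ⟨c + d, by rw [TensorProduct.add_tmul, hc, hd, map_add]; rfl⟩
    | tmul c k =>
      obtain ⟨q, hq⟩ := (isIntegrallyClosed_iff K).mp ‹_› k.2
      refine ⟨q • c, ?_⟩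
      have : (TensorProduct.toIntegralClosure Q C K (c ⊗ₜ k) : C ⊗[Q] K) = c ⊗ₜ (k : K) := rfl
      rw [this, ← hq, Algebra.algebraMap_eq_smul_one, TensorProduct.tmul_smul,
        TensorProduct.smul_tmul']
  have hinj : Function.Injective (algebraMap C (C ⊗[Q] K)) :=
    Algebra.TensorProduct.includeLeft_injective (S := C) (IsFractionRing.injective Q K)
  have hM : IsField (C ⊗[Q] K) := by
    have : Nontrivial (C ⊗[Q] K) := hinj.nontrivial
    let e := Algebra.TensorProduct.comm Q C K
    have : Nontrivial (K ⊗[Q] C) := e.injective.nontrivial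
    refine e.toMulEquiv.isField (isField_of_formallyEtale_of_isIdempotentElem (K := K) ?_)
    intro x hx
    obtain ⟨c, hc⟩ := hmem (e.symm x) (by
      refine ⟨Polynomial.X ^ 2 - Polynomial.X, ?_, ?_⟩
      · exact Polynomial.monic_X_pow_sub (by simp)
      · simp [pow_two, ← map_mul, hx])
    have hcc : c * (1 - c) = 0 := by
      apply hinj
      have : algebraMap C (C ⊗[Q] K) c = e.symm x := hc
      rw [map_mul, map_sub, map_one, map_zero, this, mul_sub, mul_one, ← map_mul, hx, sub_self]
    have key : c = 0 ∨ c = 1 := by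
      rcases IsLocalRing.isUnit_or_isUnit_of_add_one (show c + (1 - c) = 1 by ring) with h | h
      · right; exact (sub_eq_zero.mp (h.mul_right_eq_zero.mp hcc)).symm
      · left; exact h.mul_left_eq_zero.mp hcc
    rcases key with rfl | rfl
    · left
      rw [TensorProduct.zero_tmul] at hc
      exact (map_eq_zero_iff _ e.symm.injective).mp hc.symm
    · right
      exact (map_eq_one_iff _ e.symm.injective).mp hc.symm
  let _ : Field (C ⊗[Q] K) := hM.toField
  have hdom : IsDomain C := hinj.isDomain
  refine ⟨hdom, ?_⟩
  have : FaithfulSMul C (C ⊗[Q] K) := (faithfulSMul_iff_algebraMap_injective _ _).mpr hinj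
  have hfrac : IsFractionRing C (C ⊗[Q] K) := by
    refine IsFractionRing.of_field _ _ fun z => ?_
    have hmap : ∀ (q : Q) (c : C), algebraMap C (C ⊗[Q] K) (q • c) = q • algebraMap C _ c :=
      fun q c => (TensorProduct.smul_tmul' q c (1 : K)).symm
    have key : ∃ q : Q, q ≠ 0 ∧ ∃ c : C, q • z = algebraMap C _ c := by
      induction z with
      | zero => exact ⟨1, one_ne_zero, 0, by simp⟩
      | add y z hy hz =>
        obtain ⟨q, hq, c, hc⟩ := hy
        obtain ⟨r, hr, d, hd⟩ := hz
        refine ⟨q * r, mul_ne_zero hq hr, r • c + q • d, ?_⟩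
        rw [smul_add, mul_comm q r, mul_smul, hc, mul_comm r q, mul_smul, hd, map_add,
          hmap, hmap]
      | tmul c k =>
        obtain ⟨a, s, hs, rfl⟩ := IsFractionRing.div_surjective (A := Q) k
        refine ⟨s, nonZeroDivisors.ne_zero hs, a • c, ?_⟩
        have hs0 : algebraMap Q K s ≠ 0 := fun h0 =>
          nonZeroDivisors.ne_zero hs (IsFractionRing.injective Q K (by rw [h0, map_zero]))
        rw [← TensorProduct.tmul_smul, Algebra.smul_def, mul_div_cancel₀ _ hs0,
          Algebra.algebraMap_eq_smul_one, TensorProduct.tmul_smul, TensorProduct.smul_tmul']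
        rfl
    obtain ⟨q, hq, c, hc⟩ := key
    have hq0 : algebraMap C (C ⊗[Q] K) (algebraMap Q C q) ≠ 0 := by
      intro h0
      have h1 : (Algebra.TensorProduct.includeRight : K →ₐ[Q] C ⊗[Q] K) (algebraMap Q K q) = 0 := by
        rw [AlgHom.commutes, ← h0]
        rfl
      exact hq (IsFractionRing.injective Q K (((map_eq_zero _).mp h1).trans (map_zero _).symm))
    refine ⟨c, algebraMap Q C q, ?_⟩
    rw [eq_div_iff hq0, ← hc, Algebra.smul_def, mul_comm]
    rfl
  refine (isIntegrallyClosed_iff (C ⊗[Q] K)).mpr fun {x} hx => ?_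
  obtain ⟨c, hc⟩ := hmem x hx
  exact ⟨c, hc⟩

/-- The local rings of a smooth algebra over a field are normal domains. -/
theorem isDomain_and_isIntegrallyClosed_of_isSmoothAt (k : Type*) {A : Type*} [Field k]
    [CommRing A] [Algebra k A] [Algebra.FinitePresentation k A] (p : Ideal A) [p.IsPrime]
    [Algebra.IsSmoothAt k p] :
    IsDomain (Localization.AtPrime p) ∧ IsIntegrallyClosed (Localization.AtPrime p) := by
  obtain ⟨f, hf, n, _, _, _⟩ :=
    Algebra.IsSmoothAt.exists_isStandardEtale_mvPolynomial (R := k) (p := p)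
  let B := Localization.Away f
  have hdisj : Disjoint (Submonoid.powers f : Set A) p :=
    (Ideal.disjoint_powers_iff_notMem_of_isPrime _).mpr hf
  let q : Ideal B := p.map (algebraMap A B)
  have : q.IsPrime := IsLocalization.isPrime_of_isPrime_disjoint (.powers f) _ _ ‹_› hdisj
  have hq : q.comap (algebraMap A B) = p :=
    IsLocalization.under_map_of_isPrime_disjoint (.powers f) _ ‹_› hdisj
  have hloc : IsLocalization.AtPrime (Localization.AtPrime q) p := by
    have := IsLocalization.isLocalization_isLocalization_atPrime_isLocalization
      (Submonoid.powers f) (Localization.AtPrime q) q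
    simpa only [hq] using this
  have e : Localization.AtPrime p ≃+* Localization.AtPrime q :=
    (IsLocalization.algEquiv p.primeCompl _ _).toRingEquiv
  obtain ⟨h1, h2⟩ := isDomain_and_isIntegrallyClosed_of_etale (MvPolynomial (Fin n) k) q
  exact ⟨e.toMulEquiv.isDomain, .of_equiv e.symm⟩

end Normality

section Depth

open RingTheory.Sequence IsLocalRing Pointwise

universe u

lemma ofFn_X_isWeaklyRegular (k : Type*) [Field k] (n : ℕ) :
    IsWeaklyRegular (MvPolynomial (Fin n) k)
      (List.ofFn fun i => (MvPolynomial.X i : MvPolynomial (Fin n) k)) := by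
  rw [isWeaklyRegular_iff_Fin]
  intro i
  have hi : (i : ℕ) < n := by simpa using i.2
  have hspan : Ideal.ofList (List.take i (List.ofFn fun i =>
      (MvPolynomial.X i : MvPolynomial (Fin n) k))) =
      Ideal.span (MvPolynomial.X '' {j : Fin n | (j : ℕ) < i}) := by
    refine congrArg Ideal.span (Set.ext fun p => ?_)
    change p ∈ List.take _ _ ↔ _
    simp only [List.mem_take_iff_getElem, List.getElem_ofFn, Set.mem_image]
    constructor
    · rintro ⟨j, hj, rfl⟩
      exact ⟨⟨j, by simp at hj; omega⟩, by simp at hj ⊢; omega, rfl⟩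
    · rintro ⟨j, hj, rfl⟩
      exact ⟨j, lt_min hj (by simp), rfl⟩
  rw [hspan, isSMulRegular_quotient_iff_mem_of_smul_mem]
  intro p hp
  simp only [List.getElem_ofFn, smul_eq_mul, Ideal.mul_top, Fin.getElem_fin] at hp ⊢
  rw [MvPolynomial.mem_ideal_span_X_image] at hp ⊢
  intro m hm
  have hm' : Finsupp.single ⟨i, hi⟩ 1 + m ∈
      (MvPolynomial.X (⟨i, hi⟩ : Fin n) * p : MvPolynomial (Fin n) k).support := by
    rw [MvPolynomial.mem_support_iff, MvPolynomial.coeff_X_mul]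
    exact MvPolynomial.mem_support_iff.mp hm
  obtain ⟨j, hj, hne⟩ := hp _ hm'
  refine ⟨j, hj, ?_⟩
  have hij : (⟨i, hi⟩ : Fin n) ≠ j := by
    rintro rfl
    simp at hj
  simpa [Finsupp.single_apply, hij] using hne

variable {R : Type u} [CommRing R]

open CategoryTheory.Abelian ModuleCat in
lemma exists_isRegular_quotSMulTop [IsNoetherianRing R] [IsLocalRing R] (M : Type u)
    [AddCommGroup M] [Module R M] [Module.Finite R M] [Nontrivial M] {a : R}
    (ha : a ∈ maximalIdeal R) (hreg : IsSMulRegular M a) (n : ℕ)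
    (h : ∃ rs : List R, rs.length = n + 1 ∧ (∀ r ∈ rs, r ∈ maximalIdeal R) ∧ IsRegular M rs) :
    ∃ rs : List R, rs.length = n ∧ (∀ r ∈ rs, r ∈ maximalIdeal R) ∧
      IsRegular (QuotSMulTop a M) rs := by
  have lt : ∀ (N : Type u) [AddCommGroup N] [Module R N] [Module.Finite R N] [Nontrivial N],
      maximalIdeal R • (⊤ : Submodule R N) < ⊤ := by
    intro N _ _ _ _
    refine lt_top_iff_ne_top.mpr fun heq => ?_
    exact Submodule.top_ne_ideal_smul_of_le_jacobson_annihilator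
      (IsLocalRing.maximalIdeal_le_jacobson _) heq.symm
  have : Nontrivial (QuotSMulTop a M) := nontrivial_quotSMulTop_of_mem_maximalIdeal M ha
  have h1 := ((exists_isRegular_tfae (maximalIdeal R) (n + 1) (ModuleCat.of R M) (lt M)).out 3 1).mp h
  refine ((exists_isRegular_tfae (maximalIdeal R) n (ModuleCat.of R (QuotSMulTop a M))
    (lt _)).out 3 1).mpr fun i hi => ?_
  have zero1 := AddCommGrpCat.isZero_of_iff_subsingleton.mpr (h1 i (by omega))
  have zero2 := AddCommGrpCat.isZero_of_iff_subsingleton.mpr (h1 (i + 1) (by omega))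
  exact AddCommGrpCat.subsingleton_of_isZero <| ShortComplex.Exact.isZero_of_both_zeros
    ((Ext.covariant_sequence_exact₃' _
      (IsSMulRegular.smulShortComplex_shortExact (M := ModuleCat.of R M) hreg)) i (i + 1) rfl)
    (zero1.eq_zero_of_src _) (zero2.eq_zero_of_tgt _)

lemma exists_isRegular_quotient_ofList [IsNoetherianRing R] [IsLocalRing R] (rs : List R) (n : ℕ)
    (M : Type u) [AddCommGroup M] [Module R M] [Module.Finite R M] (hreg : IsRegular M rs)
    (hrs : ∀ r ∈ rs, r ∈ maximalIdeal R)
    (h : ∃ ts : List R, ts.length = n + rs.length ∧ (∀ r ∈ ts, r ∈ maximalIdeal R) ∧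
      IsRegular M ts) :
    ∃ ts : List R, ts.length = n ∧ (∀ r ∈ ts, r ∈ maximalIdeal R) ∧
      IsRegular (M ⧸ (Ideal.ofList rs • ⊤ : Submodule R M)) ts := by
  induction rs generalizing M with
  | nil =>
    obtain ⟨ts, h1, h2, h3⟩ := h
    refine ⟨ts, h1, h2, ?_⟩
    have e : M ≃ₗ[R] M ⧸ (Ideal.ofList ([] : List R) • ⊤ : Submodule R M) :=
      ((Submodule.quotEquivOfEqBot _ (by simp))).symm
    exact (e.isRegular_congr ts).mp h3
  | cons r rs ih =>
    have := hreg.nontrivial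
    rw [isRegular_cons_iff] at hreg
    obtain ⟨ts, h1, h2, h3⟩ := ih (QuotSMulTop r M) hreg.2 (fun t ht => hrs t (by simp [ht]))
      (exists_isRegular_quotSMulTop M (hrs r (by simp)) hreg.1 _ (by simpa [add_assoc] using h))
    exact ⟨ts, h1, h2, ((Submodule.quotOfListConsSMulTopEquivQuotSMulTopInner M r rs).isRegular_congr
      ts).mpr h3⟩

/-- If the maximal ideal of a Noetherian local ring contains a regular sequence which is longer by
two than a given one, the quotient by the latter has depth at least two. -/
lemma exists_regular_pair_quotient [IsNoetherianRing R] [IsLocalRing R] {rs : List R}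
    (hreg : IsRegular R rs) (hrs : ∀ r ∈ rs, r ∈ maximalIdeal R)
    (h : ∃ ts : List R, ts.length = 2 + rs.length ∧ (∀ r ∈ ts, r ∈ maximalIdeal R) ∧
      IsRegular R ts) :
    ∃ a ∈ maximalIdeal R, ∃ b ∈ maximalIdeal R,
      Ideal.Quotient.mk (Ideal.ofList rs) a ∈ nonZeroDivisors (R ⧸ Ideal.ofList rs) ∧
      ∀ x, Ideal.Quotient.mk (Ideal.ofList rs) b * x ∈
        Ideal.span {Ideal.Quotient.mk (Ideal.ofList rs) a} →
        x ∈ Ideal.span {Ideal.Quotient.mk (Ideal.ofList rs) a} := by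
  obtain ⟨ts, h1, h2, h3⟩ := exists_isRegular_quotient_ofList rs 2 R hreg hrs h
  obtain ⟨a, b, rfl⟩ := List.length_eq_two.mp h1
  have e : (R ⧸ (Ideal.ofList rs • ⊤ : Submodule R R)) ≃ₗ[R] R ⧸ Ideal.ofList rs :=
    Submodule.quotEquivOfEq _ _ (by simp)
  have h4 := ((e.isRegular_congr _).mp h3).toIsWeaklyRegular
  rw [isWeaklyRegular_cons_iff, isWeaklyRegular_singleton_iff] at h4
  refine ⟨a, h2 a (by simp), b, h2 b (by simp), ?_, ?_⟩
  · rw [mem_nonZeroDivisors_iff_right]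
    intro x hx
    refine h4.1 ?_
    change a • x = a • 0
    rw [smul_zero, Algebra.smul_def, mul_comm]
    exact hx
  · intro x hx
    have := (isSMulRegular_quotient_iff_mem_of_smul_mem _ _).mp h4.2 x
    simp only [Submodule.mem_smul_pointwise_iff_exists, Submodule.mem_top, true_and] at this
    obtain ⟨y, hy⟩ := Ideal.mem_span_singleton.mp hx
    obtain ⟨z, hz⟩ := this ⟨y, by rw [Algebra.smul_def, Algebra.smul_def]; exact hy.symm⟩
    exact Ideal.mem_span_singleton.mpr ⟨z, by rw [← hz, Algebra.smul_def]; rfl⟩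

lemma ofList_take_eq_of_sub_mem {rs ts : List R} (hlen : rs.length = ts.length)
    (h : ∀ (i : ℕ) (hi : i < rs.length), ts[i]'(hlen ▸ hi) - rs[i] ∈ Ideal.ofList (rs.take i))
    (i : ℕ) : Ideal.ofList (ts.take i) = Ideal.ofList (rs.take i) := by
  induction i with
  | zero => simp
  | succ i ih =>
    by_cases hi : i < rs.length
    · rw [List.take_succ_eq_append_getElem hi, List.take_succ_eq_append_getElem (hlen ▸ hi),
        Ideal.ofList_append, Ideal.ofList_append, ih, Ideal.ofList_singleton,
        Ideal.ofList_singleton]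
      have hd := h i hi
      apply le_antisymm <;> refine sup_le le_sup_left ?_ <;>
        rw [Ideal.span_singleton_le_iff_mem]
      · have := Ideal.add_mem _ (Ideal.mem_sup_left hd : _ ∈ _ ⊔ Ideal.span {rs[i]})
          (Ideal.mem_sup_right (Ideal.mem_span_singleton_self _))
        simpa using this
      · have := Ideal.sub_mem _ (Ideal.mem_sup_right (Ideal.mem_span_singleton_self (ts[i]'(hlen ▸ hi))))
          (Ideal.mem_sup_left hd)
        simpa using this
    · rw [List.take_of_length_le (by omega), List.take_of_length_le (by omega)] at ih ⊢
      exact ih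

/-- A unitriangular change of a weakly regular sequence is weakly regular. -/
lemma isWeaklyRegular_of_sub_mem {rs ts : List R} (hlen : rs.length = ts.length)
    (h : ∀ (i : ℕ) (hi : i < rs.length), ts[i]'(hlen ▸ hi) - rs[i] ∈ Ideal.ofList (rs.take i))
    (hreg : IsWeaklyRegular R rs) : IsWeaklyRegular R ts := by
  rw [isWeaklyRegular_iff_Fin] at hreg ⊢
  rintro ⟨i, hi⟩
  have hi' : i < rs.length := hlen ▸ hi
  have h1 := hreg ⟨i, hi'⟩
  rw [isSMulRegular_quotient_iff_mem_of_smul_mem] at h1 ⊢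
  intro x hx
  rw [ofList_take_eq_of_sub_mem hlen h i] at hx ⊢
  refine h1 x ?_
  simp only [smul_eq_mul, Ideal.mul_top, Fin.getElem_fin] at hx ⊢
  have := Ideal.sub_mem _ hx (Ideal.mul_mem_right x _ (h i hi'))
  convert this using 1
  ring

/-- In a Noetherian local ring, if `f` is a regular sequence then so is the sequence of the
`f i + l i * f (i + 1)`. -/
lemma isRegular_ofFn_add_mul [IsNoetherianRing R] [IsLocalRing R] {n : ℕ} (f : Fin (n + 1) → R)
    (hf : ∀ i, f i ∈ maximalIdeal R) (hreg : IsRegular R (List.ofFn f)) (l : Fin n → R) :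
    IsRegular R (List.ofFn fun i : Fin n => f i.castSucc + l i * f i.succ) := by
  let h : Fin (n + 1) → R := Fin.snoc (fun i : Fin n => f i.castSucc + l i * f i.succ) (f (Fin.last n))
  have hh : ∀ i, h i ∈ maximalIdeal R := by
    intro i
    induction i using Fin.lastCases with
    | last => simpa [h] using hf _
    | cast i => simpa [h] using Ideal.add_mem _ (hf _) (Ideal.mul_mem_left _ _ (hf _))
  have hrev : IsRegular R (List.ofFn fun i => f i.rev) :=
    IsLocalRing.isRegular_of_perm hreg (Equiv.Perm.ofFn_comp_perm Fin.revPerm f).symm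
  have hweak : IsWeaklyRegular R (List.ofFn fun i => h i.rev) := by
    refine isWeaklyRegular_of_sub_mem (rs := List.ofFn fun i => f i.rev) (by simp) ?_
      hrev.toIsWeaklyRegular
    intro i hi
    have hi' : i < n + 1 := by simpa using hi
    simp only [List.getElem_ofFn]
    rcases Nat.eq_zero_or_pos i with rfl | hpos
    · have : Fin.rev (⟨0, hi'⟩ : Fin (n + 1)) = Fin.last n := by ext; simp
      rw [this]
      simp [h]
    · obtain ⟨j, hj⟩ : ∃ j : Fin n, Fin.rev (⟨i, hi'⟩ : Fin (n + 1)) = j.castSucc :=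
        ⟨⟨n - i, by omega⟩, by ext; simp [Fin.val_rev]; try omega⟩
      have hsucc : j.succ = Fin.rev (⟨i - 1, by omega⟩ : Fin (n + 1)) := by
        have := congrArg Fin.val hj
        simp [Fin.val_rev] at this
        ext; simp [Fin.val_rev]; omega
      rw [hj]
      simp only [h, Fin.snoc_castSucc, add_sub_cancel_left]
      refine Ideal.mul_mem_left _ _ (Ideal.subset_span ?_)
      simp only [Set.mem_ofPred_eq, List.mem_take_iff_getElem, List.getElem_ofFn]
      exact ⟨i - 1, by simp; omega, by rw [hsucc]⟩
  have hreg' : IsRegular R (List.ofFn h) := by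
    have : IsRegular R (List.ofFn fun i => h i.rev) :=
      .of_isWeaklyRegular_of_mem_maximalIdeal R (by
        intro r hr
        obtain ⟨i, rfl⟩ := (List.mem_ofFn' _ _).mp hr
        exact hh _) hweak
    exact IsLocalRing.isRegular_of_perm this (Equiv.Perm.ofFn_comp_perm Fin.revPerm h)
  have happ : List.ofFn h = (List.ofFn fun i : Fin n => f i.castSucc + l i * f i.succ) ++
      [f (Fin.last n)] := by
    rw [List.ofFn_succ']
    simp [h]
  rw [happ] at hreg'
  exact .of_isWeaklyRegular_of_mem_maximalIdeal R (by
    intro r hr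
    obtain ⟨i, rfl⟩ := (List.mem_ofFn' _ _).mp hr
    exact Ideal.add_mem _ (hf _) (Ideal.mul_mem_left _ _ (hf _)))
    ((isWeaklyRegular_append_iff _ _ _).mp hreg'.toIsWeaklyRegular).1

end Depth

section Points

open MvPolynomial

lemma height_eq_of_isMaximal (k : Type*) [Field k] (n : ℕ) (P : Ideal (MvPolynomial (Fin n) k))
    [hP : P.IsMaximal] : P.height = n := by
  induction n with
  | zero =>
    refine le_antisymm ?_ (by simp)
    have h := Ideal.height_le_ringKrullDim_of_ne_top hP.ne_top
    rw [MvPolynomial.ringKrullDim_of_isNoetherianRing] at h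
    simpa using h
  | succ n ih =>
    let e := (finSuccEquiv k n).toRingEquiv
    let P' : Ideal (Polynomial (MvPolynomial (Fin n) k)) := P.map e
    have : P'.IsMaximal := Ideal.map_isMaximal_of_equiv e
    have : (P'.under (MvPolynomial (Fin n) k)).IsMaximal :=
      Polynomial.isMaximal_comap_C_of_isJacobsonRing P'
    have : P'.LiesOver (P'.under (MvPolynomial (Fin n) k)) := Ideal.over_under P'
    have h := Polynomial.height_eq_height_add_one (P'.under (MvPolynomial (Fin n) k)) P'
    rw [ih, RingEquiv.height_map] at h
    exact_mod_cast h

variable {k σ : Type*} [Field k]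

lemma taylor_mem [Fintype σ] (a : σ → k) (p : MvPolynomial σ k) :
    p - C (eval a p) - ∑ j, C (eval a (pderiv j p)) * (X j - C (a j)) ∈
      vanishingIdeal k {a} ^ 2 := by
  classical
  have hX : ∀ j, (X j - C (a j) : MvPolynomial σ k) ∈ vanishingIdeal k {a} := by
    intro j
    rw [mem_vanishingIdeal_singleton_iff]
    simp
  have hlin : ∀ p : MvPolynomial σ k, ∑ j, C (eval a (pderiv j p)) * (X j - C (a j)) ∈
      vanishingIdeal k {a} := fun p =>
    Ideal.sum_mem _ fun j _ => Ideal.mul_mem_left _ _ (hX j)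
  induction p using MvPolynomial.induction_on with
  | C r => simp
  | add p q hp hq =>
    convert Ideal.add_mem _ hp hq using 1
    simp only [map_add, add_mul, Finset.sum_add_distrib]
    ring
  | mul_X p i hp =>
    have h1 := Ideal.mul_mem_right (X i) _ hp
    have h2 : (∑ j, C (eval a (pderiv j p)) * (X j - C (a j))) * (X i - C (a i)) ∈
        vanishingIdeal k {a} ^ 2 := by
      rw [pow_two]
      exact Ideal.mul_mem_mul (hlin p) (hX i)
    convert Ideal.add_mem _ h1 h2 using 1
    have h3 : ∑ j, C (eval a (pderiv j (p * X i))) * (X j - C (a j)) =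
        C (eval a p) * (X i - C (a i)) +
          C (a i) * ∑ j, C (eval a (pderiv j p)) * (X j - C (a j)) := by
      simp only [Derivation.leibniz, pderiv_X, smul_eq_mul, map_add, map_mul, eval_X, add_mul,
        Finset.sum_add_distrib, Finset.mul_sum]
      congr 1
      · rw [Finset.sum_eq_single i]
        · simp
        · intro j _ hj
          simp [hj.symm]
        · simp
      · exact Finset.sum_congr rfl fun j _ => by ring
    rw [h3]
    simp only [map_mul, eval_X]
    ring

lemma mem_sq_of_pderiv_eq_zero [Fintype σ] {a : σ → k} {p : MvPolynomial σ k} (h0 : eval a p = 0)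
    (h1 : ∀ j, eval a (pderiv j p) = 0) : p ∈ vanishingIdeal k {a} ^ 2 := by
  simpa [h0, h1] using taylor_mem a p

end Points

section LocalizationQuotient

variable {R : Type*} [CommRing R]

lemma isLocalization_atPrime_quotient (J : Ideal R) (q : Ideal (R ⧸ J)) [q.IsPrime]
    (p : Ideal R) [p.IsPrime] (hp : q.comap (Ideal.Quotient.mk J) = p) (S : Type*) [CommRing S]
    [Algebra R S] [IsLocalization.AtPrime S p] :
    IsLocalization.AtPrime (S ⧸ J.map (algebraMap R S)) q := by
  have : Algebra.algebraMapSubmonoid (R ⧸ J) p.primeCompl = q.primeCompl := by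
    ext x
    obtain ⟨y, rfl⟩ := Ideal.Quotient.mk_surjective x
    subst hp
    constructor
    · rintro ⟨z, hz, hzy⟩
      rw [← hzy]
      exact hz
    · intro hy
      exact ⟨y, hy, rfl⟩
  unfold IsLocalization.AtPrime
  rw [← this]
  infer_instance

/-- The local ring of `Spec (R ⧸ J)` at a prime, as a quotient of a local ring of `R`. -/
noncomputable def localizationQuotientEquiv (J : Ideal R) (q : Ideal (R ⧸ J)) [q.IsPrime]
    (p : Ideal R) [p.IsPrime] (hp : q.comap (Ideal.Quotient.mk J) = p) :
    Localization.AtPrime q ≃+*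
      Localization.AtPrime p ⧸ J.map (algebraMap R (Localization.AtPrime p)) :=
  have := isLocalization_atPrime_quotient J q p hp (Localization.AtPrime p)
  (IsLocalization.algEquiv q.primeCompl _ _).toRingEquiv

end LocalizationQuotient

section JacobianSmooth

open MvPolynomial

variable {K : Type*} [Field K] {n k : ℕ}

/-- The Jacobian criterion: the nonvanishing locus of a maximal minor of the Jacobian matrix is
standard smooth. -/
lemma isStandardSmoothOfRelativeDimension_away (h : Fin k → MvPolynomial (Fin n) K)
    (s : Fin k → Fin n) (hs : Function.Injective s) :
    Algebra.IsStandardSmoothOfRelativeDimension (n - k) K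
      (Localization.Away (Ideal.Quotient.mk (Ideal.span (Set.range h))
        (Matrix.of fun i j => pderiv (s i) (h j)).det)) := by
  let A := MvPolynomial (Fin n) K ⧸ Ideal.span (Set.range h)
  let P : Algebra.PreSubmersivePresentation K A (Fin n) (Fin k) :=
    Algebra.PreSubmersivePresentation.naive s hs
  have hjac : P.jacobian =
      Ideal.Quotient.mk _ (Matrix.of fun i j => pderiv (s i) (h j)).det := by
    rw [Algebra.PreSubmersivePresentation.jacobian_eq_jacobiMatrix_det]
    have : P.jacobiMatrix = Matrix.of fun i j => pderiv (s i) (h j) := by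
      ext1 i j
      exact Algebra.PreSubmersivePresentation.jacobiMatrix_naive s hs _ _ i j
    rw [this]
    rfl
  rw [← hjac]
  let Q := Algebra.SubmersivePresentation.localizationAway (Localization.Away P.jacobian) P.jacobian
  let T : Algebra.SubmersivePresentation K (Localization.Away P.jacobian) (Unit ⊕ Fin n)
      (Unit ⊕ Fin k) :=
    { toPreSubmersivePresentation := Q.toPreSubmersivePresentation.comp P
      jacobian_isUnit := by
        rw [Algebra.PreSubmersivePresentation.comp_jacobian_eq_jacobian_smul_jacobian,
          Algebra.smul_def]
        exact (IsLocalization.Away.algebraMap_isUnit P.jacobian).mul Q.jacobian_isUnit }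
  refine T.isStandardSmoothOfRelativeDimension ?_
  change Nat.card (Unit ⊕ Fin n) - Nat.card (Unit ⊕ Fin k) = n - k
  simp
  omega

lemma injective_of_det_ne_zero {A : Type*} [CommRing A] {M : Matrix (Fin n) (Fin k) A}
    {s : Fin k → Fin n} (h : (M.submatrix s id).det ≠ 0) : Function.Injective s := by
  intro i j hij
  by_contra hne
  exact h (Matrix.det_zero_of_row_eq hne (by ext; simp [hij]))

lemma isSmoothAt_and_height_le (h : Fin k → MvPolynomial (Fin n) K)
    (s : Fin k → Fin n) (q : Ideal (MvPolynomial (Fin n) K ⧸ Ideal.span (Set.range h)))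
    [q.IsPrime]
    (hq : Ideal.Quotient.mk (Ideal.span (Set.range h))
        (Matrix.of fun i j => pderiv (s i) (h j)).det ∉ q) :
    Algebra.IsSmoothAt K q ∧ q.height ≤ ((n - k : ℕ) : ℕ∞) := by
  have hs : Function.Injective s := by
    refine injective_of_det_ne_zero (M := Matrix.of fun i j => pderiv i (h j)) ?_
    intro h0
    refine hq ?_
    have : (Matrix.of fun i j => pderiv (s i) (h j)).det = 0 := h0
    rw [this, map_zero]
    exact zero_mem q
  have hsm := isStandardSmoothOfRelativeDimension_away h s hs
  set d := Ideal.Quotient.mk (Ideal.span (Set.range h))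
        (Matrix.of fun i j => pderiv (s i) (h j)).det
  constructor
  · have : Algebra.IsStandardSmooth K (Localization.Away d) :=
      Algebra.IsStandardSmoothOfRelativeDimension.isStandardSmooth (n - k)
    have : Algebra.FinitePresentation K (MvPolynomial (Fin n) K ⧸ Ideal.span (Set.range h)) :=
      Algebra.FinitePresentation.of_finiteType.mp inferInstance
    have h1 := Algebra.basicOpen_subset_smoothLocus_iff_smooth.mpr
      (inferInstance : Algebra.Smooth K (Localization.Away d))
    exact h1 (show (⟨q, ‹_›⟩ : PrimeSpectrum _) ∈ PrimeSpectrum.basicOpen d from hq)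
  · obtain ⟨φ, hφ⟩ := Algebra.IsStandardSmoothOfRelativeDimension.exists_etale_mvPolynomial (n - k) K
      (Localization.Away d)
    algebraize [φ.toRingHom]
    have hdim : ringKrullDim (Localization.Away d) ≤ (n - k : ℕ) := by
      have : Algebra.Etale (MvPolynomial (Fin (n - k)) K) (Localization.Away d) := hφ
      calc ringKrullDim (Localization.Away d) ≤ ringKrullDim (MvPolynomial (Fin (n - k)) K) := by
            refine Order.krullDim_le_of_strictMono
              (PrimeSpectrum.comap (algebraMap (MvPolynomial (Fin (n - k)) K) _)) ?_
            intro P Q hPQ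
            refine lt_of_le_of_ne (Ideal.comap_mono hPQ.le) fun heq => hPQ.ne ?_
            exact PrimeSpectrum.ext (Algebra.QuasiFinite.eq_of_le_of_under_eq
              (R := MvPolynomial (Fin (n - k)) K) _ _ hPQ.le
              (congrArg PrimeSpectrum.asIdeal heq))
        _ = _ := by simp
    have hdisj := (Ideal.disjoint_powers_iff_notMem_of_isPrime _).mpr hq
    have : (q.map (algebraMap _ (Localization.Away d))).IsPrime :=
      IsLocalization.isPrime_of_isPrime_disjoint (.powers d) _ _ ‹_› hdisj
    rw [← IsLocalization.height_map_of_disjoint (S := Localization.Away d) (.powers d) q hdisj]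
    have := (Ideal.height_le_ringKrullDim_of_isPrime
      (I := q.map (algebraMap _ (Localization.Away d)))).trans hdim
    exact WithBot.coe_le_coe.mp this

end JacobianSmooth

section JacobianConverse

open MvPolynomial IsLocalRing RingTheory.Sequence

lemma isPrincipal_maximalIdeal_of_dim_le_one (B : Type*) [CommRing B] [IsNoetherianRing B]
    [IsLocalRing B] [IsDomain B] [IsIntegrallyClosed B] (h : ringKrullDim B ≤ 1) :
    (maximalIdeal B).IsPrincipal := by
  have : Ring.KrullDimLE 1 B := by
    rw [Ring.krullDimLE_iff]
    exact_mod_cast h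
  have htfae := (tfae_of_isNoetherianRing_of_isLocalRing_of_isDomain B).out 3 4
  refine htfae.mp ⟨inferInstance, ?_⟩
  intro P hP hP'
  exact eq_maximalIdeal (Ideal.isMaximal_of_isPrime_of_ne_bot P hP)

/-- If a quotient of a Noetherian local ring `S` by elements `t i` has principal maximal ideal and
`dim S` is at least the number of the `t i` plus one, then
the `t i` are linearly independent modulo the square of the maximal ideal. -/
lemma eq_zero_of_sum_mem_sq {S : Type*} [CommRing S] [IsNoetherianRing S] [IsLocalRing S]
    {g : ℕ} (t : Fin g → S) (c : S)
    (hc : maximalIdeal S = Ideal.span {c} ⊔ Ideal.span (Set.range t))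
    (hdim : (g : WithBot ℕ∞) + 1 ≤ ringKrullDim S) (w : Fin g → S)
    (hw : ∑ i, w i * t i ∈ maximalIdeal S ^ 2) (i : Fin g) : ¬ IsUnit (w i) := by
  classical
  intro hu
  let I' : Ideal S := Ideal.span (insert c (t '' {j | j ≠ i}))
  have ht : ∀ j, j ≠ i → t j ∈ I' := fun j hj =>
    Ideal.subset_span (Set.mem_insert_of_mem _ ⟨j, hj, rfl⟩)
  have hti : t i ∈ I' ⊔ maximalIdeal S • maximalIdeal S := by
    rw [← Ideal.unit_mul_mem_iff_mem _ hu]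
    have h1 : w i * t i = ∑ j, w j * t j - ∑ j ∈ Finset.univ.erase i, w j * t j := by
      rw [← Finset.add_sum_erase _ _ (Finset.mem_univ i)]
      ring
    rw [h1]
    refine Ideal.sub_mem _ (Ideal.mem_sup_right ?_) (Ideal.mem_sup_left ?_)
    · rwa [smul_eq_mul, ← pow_two]
    · exact Ideal.sum_mem _ fun j hj => Ideal.mul_mem_left _ _ (ht j (Finset.ne_of_mem_erase hj))
  have hle : maximalIdeal S ≤ I' := by
    refine Submodule.le_of_le_smul_of_le_jacobson_bot (I := maximalIdeal S)
      (IsNoetherian.noetherian _) (maximalIdeal_le_jacobson _) ?_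
    conv_lhs => rw [hc]
    refine sup_le ?_ (Ideal.span_le.mpr ?_)
    · rw [Ideal.span_singleton_le_iff_mem]
      exact Ideal.mem_sup_left (Ideal.subset_span (Set.mem_insert _ _))
    · rintro _ ⟨j, rfl⟩
      by_cases hj : j = i
      · exact hj ▸ hti
      · exact Ideal.mem_sup_left (ht j hj)
  have hge : I' ≤ maximalIdeal S := by
    rw [Ideal.span_le, hc]
    rintro x (rfl | ⟨j, -, rfl⟩)
    · exact Ideal.mem_sup_left (Ideal.mem_span_singleton_self _)
    · exact Ideal.mem_sup_right (Ideal.subset_span ⟨j, rfl⟩)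
  have h1 := ringKrullDim_le_spanFinrank_maximalIdeal S
  rw [le_antisymm hle hge] at h1
  have h2 : I'.spanFinrank ≤ g := by
    refine (Submodule.spanFinrank_span_le_ncard_of_finite (Set.toFinite _)).trans ?_
    refine (Set.ncard_insert_le _ _).trans ?_
    have h3 : (t '' {j | j ≠ i}).ncard ≤ g - 1 := by
      refine (Set.ncard_image_le (Set.toFinite _)).trans ?_
      have : {j | j ≠ i} = ((Finset.univ.erase i : Finset (Fin g)) : Set (Fin g)) := by
        ext; simp
      rw [this, Set.ncard_coe_finset, Finset.card_erase_of_mem (Finset.mem_univ i)]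
      simp
    have := i.pos
    omega
  have h3 : (g : WithBot ℕ∞) + 1 ≤ g := hdim.trans (h1.trans (by exact_mod_cast h2))
  have h4 : g + 1 ≤ g := by exact_mod_cast h3
  omega

variable {K : Type*} [Field K]

/-- At a smooth point of a complete intersection curve the gradients of the equations
are linearly independent. -/
lemma linearIndependent_pderiv_of_isSmoothAt {g : ℕ} (f : Fin g → MvPolynomial (Fin (g + 1)) K)
    (hreg : IsWeaklyRegular (MvPolynomial (Fin (g + 1)) K) (List.ofFn f)) (a : Fin (g + 1) → K)
    (hf : ∀ i, eval a (f i) = 0)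
    (q : Ideal (MvPolynomial (Fin (g + 1)) K ⧸ Ideal.span (Set.range f))) [q.IsPrime]
    (hq : q.comap (Ideal.Quotient.mk _) = vanishingIdeal K {a}) [Algebra.IsSmoothAt K q] :
    LinearIndependent K fun i j => eval a (pderiv j (f i)) := by
  let R := MvPolynomial (Fin (g + 1)) K
  let J : Ideal R := Ideal.span (Set.range f)
  let m : Ideal R := vanishingIdeal K {a}
  have hm : m.IsMaximal := inferInstance
  let S := Localization.AtPrime m
  have hmem : ∀ p : R, p ∈ m ↔ eval a p = 0 := fun p => by
    rw [mem_vanishingIdeal_singleton_iff]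
    rfl
  have hregS : IsRegular S ((List.ofFn f).map (algebraMap R S)) :=
    hreg.isRegular_of_isLocalization_of_mem S m (by
      intro r hr
      obtain ⟨i, rfl⟩ := (List.mem_ofFn' _ _).mp hr
      exact (hmem _).mpr (hf i))
  have hJ : Ideal.ofList ((List.ofFn f).map (algebraMap R S)) = J.map (algebraMap R S) := by
    rw [Ideal.map_span]
    refine congrArg Ideal.span (Set.ext fun x => ?_)
    change x ∈ List.map _ _ ↔ _
    simp [List.mem_ofFn']
  have hdimS : ringKrullDim S = (g : WithBot ℕ∞) + 1 := by
    rw [IsLocalization.AtPrime.ringKrullDim_eq_height m S, height_eq_of_isMaximal K (g + 1) m]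
    push_cast
    rfl
  have hdim : ringKrullDim (S ⧸ J.map (algebraMap R S)) ≤ 1 := by
    have h := ringKrullDim_add_length_eq_ringKrullDim_of_isRegular _ hregS
    rw [hJ, hdimS] at h
    simp only [List.length_map, List.length_ofFn] at h
    rw [add_comm (g : WithBot ℕ∞) 1] at h
    exact (ENat.WithBot.add_le_add_natCast_right_iff.mp h.le)
  have : Algebra.FinitePresentation K (R ⧸ J) := Algebra.FinitePresentation.of_finiteType.mp inferInstance
  obtain ⟨h1, h2⟩ := isDomain_and_isIntegrallyClosed_of_isSmoothAt K q
  let e := localizationQuotientEquiv J q m hq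
  have : IsDomain (S ⧸ J.map (algebraMap R S)) := e.symm.toMulEquiv.isDomain
  have : IsIntegrallyClosed (S ⧸ J.map (algebraMap R S)) :=
    IsIntegrallyClosed.of_equiv (R := Localization.AtPrime q) e
  have : IsLocalRing (S ⧸ J.map (algebraMap R S)) := e.isLocalRing
  obtain ⟨⟨c, hc⟩⟩ := isPrincipal_maximalIdeal_of_dim_le_one
    (S ⧸ J.map (algebraMap R S)) hdim
  obtain ⟨c, rfl⟩ := Ideal.Quotient.mk_surjective c
  have hmax : maximalIdeal S = Ideal.span {c} ⊔ Ideal.span (Set.range fun i => algebraMap R S (f i)) := by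
    have h3 : (maximalIdeal (S ⧸ J.map (algebraMap R S))).comap (Ideal.Quotient.mk _) = maximalIdeal S :=
      eq_maximalIdeal (Ideal.comap_isMaximal_of_surjective _ Ideal.Quotient.mk_surjective)
    have h4 : maximalIdeal (S ⧸ J.map (algebraMap R S)) =
        (Ideal.span {c}).map (Ideal.Quotient.mk _) := by
      refine hc.trans ((Ideal.map_span _ _).trans ?_).symm
      rw [Set.image_singleton]
    rw [← h3, h4, Ideal.comap_map_of_surjective _ Ideal.Quotient.mk_surjective, ← RingHom.ker_eq_comap_bot,
      Ideal.mk_ker, Ideal.map_span, ← Set.range_comp]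
    rfl
  rw [Fintype.linearIndependent_iff]
  intro w hw i
  by_contra hwi
  refine eq_zero_of_sum_mem_sq (fun i => algebraMap R S (f i)) c hmax hdimS.ge
    (fun i => algebraMap R S (C (w i))) ?_ i ?_
  · have h3 : ∑ i, C (w i) * f i ∈ m ^ 2 := by
      refine mem_sq_of_pderiv_eq_zero (by simp [hf]) fun j => ?_
      have := congrFun hw j
      simpa using this
    have h4 := Ideal.mem_map_of_mem (algebraMap R S) h3
    rw [Ideal.map_pow, Localization.AtPrime.map_eq_maximalIdeal] at h4
    simpa using h4
  · exact ((Ne.isUnit hwi).map C).map (algebraMap R S)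

end JacobianConverse

section OriginDepth

open MvPolynomial IsLocalRing RingTheory.Sequence

lemma isDomain_and_isIntegrallyClosed_of_ringEquiv {A B : Type*} [CommRing A] [CommRing B]
    (e : A ≃+* B) (h : IsDomain A ∧ IsIntegrallyClosed A) : IsDomain B ∧ IsIntegrallyClosed B := by
  obtain ⟨h1, h2⟩ := h
  exact ⟨e.symm.toMulEquiv.isDomain, IsIntegrallyClosed.of_equiv e⟩

/-- Normality of the localization of a localization. -/
lemma localization_localization_normal {A : Type*} [CommRing A] (q : Ideal A) [q.IsPrime]
    (h : ∀ p : Ideal A, ∀ [p.IsPrime], p ≠ q →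
      IsDomain (Localization.AtPrime p) ∧ IsIntegrallyClosed (Localization.AtPrime p))
    (P : Ideal (Localization.AtPrime q)) [P.IsPrime] (hP : P ≠ maximalIdeal _) :
    IsDomain (Localization.AtPrime P) ∧ IsIntegrallyClosed (Localization.AtPrime P) := by
  let p : Ideal A := P.comap (algebraMap A (Localization.AtPrime q))
  have hp : p ≠ q := by
    intro hpq
    refine hP ?_
    rw [← IsLocalization.map_under q.primeCompl (Localization.AtPrime q) P,
      ← Localization.AtPrime.map_eq_maximalIdeal]
    exact congrArg (Ideal.map (algebraMap A (Localization.AtPrime q))) hpq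
  have := IsLocalization.isLocalization_isLocalization_atPrime_isLocalization q.primeCompl
    (Localization.AtPrime P) P
  exact isDomain_and_isIntegrallyClosed_of_ringEquiv
    (IsLocalization.algEquiv p.primeCompl (Localization.AtPrime p)
      (Localization.AtPrime P)).toRingEquiv (h p hp)

variable {K : Type*} [Field K] {n : ℕ}

lemma isRegular_localization_ofFn {m : ℕ} (f : Fin m → MvPolynomial (Fin n) K)
    (hreg : IsWeaklyRegular (MvPolynomial (Fin n) K) (List.ofFn f)) (a : Fin n → K)
    (hf : ∀ i, eval a (f i) = 0) :
    IsRegular (Localization.AtPrime (vanishingIdeal K {a}))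
      (List.ofFn fun i => algebraMap _ (Localization.AtPrime (vanishingIdeal K {a})) (f i)) := by
  have h := hreg.isRegular_of_isLocalization_of_mem
    (Localization.AtPrime (vanishingIdeal K {a})) (vanishingIdeal K {a}) (by
      intro r hr
      obtain ⟨i, rfl⟩ := (List.mem_ofFn' _ _).mp hr
      rw [mem_vanishingIdeal_singleton_iff]
      exact hf i)
  rwa [List.map_ofFn] at h

lemma ofList_ofFn {R : Type*} [CommRing R] {m : ℕ} (f : Fin m → R) :
    Ideal.ofList (List.ofFn f) = Ideal.span (Set.range f) := by
  refine congrArg Ideal.span (Set.ext fun x => ?_)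
  change x ∈ List.ofFn f ↔ _
  simp [List.mem_ofFn']

/-- The polynomials `f_i + l_i f_{i+1}`. -/
noncomputable abbrev consecutiveSums (f : Fin (n + 1) → MvPolynomial (Fin (n + 2)) K) (l : Fin n → K) :
    Fin n → MvPolynomial (Fin (n + 2)) K :=
  fun i => f i.castSucc + C (l i) * f i.succ

lemma isRegular_localization_consecutiveSums (f : Fin (n + 1) → MvPolynomial (Fin (n + 2)) K)
    (hreg : IsWeaklyRegular (MvPolynomial (Fin (n + 2)) K) (List.ofFn f))
    (a : Fin (n + 2) → K) (hf : ∀ i, eval a (f i) = 0) (l : Fin n → K) :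
    IsRegular (Localization.AtPrime (vanishingIdeal K {a}))
      (List.ofFn fun i : Fin n =>
        algebraMap (MvPolynomial (Fin (n + 2)) K) (Localization.AtPrime (vanishingIdeal K {a}))
          (consecutiveSums f l i)) := by
  have h := isRegular_ofFn_add_mul _ (fun i => ?_) (isRegular_localization_ofFn f hreg a hf)
    (fun i => algebraMap (MvPolynomial (Fin (n + 2)) K) _ (C (l i)))
  · simpa only [map_add, map_mul] using h
  · rw [IsLocalization.AtPrime.to_map_mem_maximal_iff _ (vanishingIdeal K {a}),
      mem_vanishingIdeal_singleton_iff]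
    exact hf i

lemma ofList_localization_consecutiveSums (f : Fin (n + 1) → MvPolynomial (Fin (n + 2)) K)
    (l : Fin n → K) (S : Type*) [CommRing S] [Algebra (MvPolynomial (Fin (n + 2)) K) S] :
    Ideal.ofList (List.ofFn fun i : Fin n =>
        algebraMap (MvPolynomial (Fin (n + 2)) K) S (consecutiveSums f l i)) =
      (Ideal.span (Set.range (consecutiveSums f l))).map
        (algebraMap (MvPolynomial (Fin (n + 2)) K) S) := by
  rw [ofList_ofFn, Ideal.map_span, ← Set.range_comp]
  rfl

lemma height_of_mem_base (f : Fin (n + 1) → MvPolynomial (Fin (n + 2)) K)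
    (hreg : IsWeaklyRegular (MvPolynomial (Fin (n + 2)) K) (List.ofFn f))
    (a : Fin (n + 2) → K) (hf : ∀ i, eval a (f i) = 0) (l : Fin n → K)
    (q : Ideal (MvPolynomial (Fin (n + 2)) K ⧸ Ideal.span (Set.range (consecutiveSums f l))))
    [q.IsPrime] (hq : q.comap (Ideal.Quotient.mk _) = vanishingIdeal K {a}) : q.height = 2 := by
  have h := ringKrullDim_add_length_eq_ringKrullDim_of_isRegular _
    (isRegular_localization_consecutiveSums f hreg a hf l)
  have hm : (vanishingIdeal K {a}).IsMaximal := inferInstance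
  rw [ofList_localization_consecutiveSums, IsLocalization.AtPrime.ringKrullDim_eq_height
      (vanishingIdeal K {a}) (Localization.AtPrime (vanishingIdeal K {a})),
    height_eq_of_isMaximal K (n + 2) (vanishingIdeal K {a}),
    ← ringKrullDim_eq_of_ringEquiv (localizationQuotientEquiv _ q _ hq),
    IsLocalization.AtPrime.ringKrullDim_eq_height q (Localization.AtPrime q),
    List.length_ofFn] at h
  have h2 : ((n + 2 : ℕ) : WithBot ℕ∞) = 2 + (n : ℕ) := by
    push_cast
    rw [add_comm]
  rw [show ((((n + 2 : ℕ) : ℕ∞) : WithBot ℕ∞)) = 2 + (n : ℕ) from h2] at h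
  exact WithBot.coe_injective (ENat.WithBot.add_natCast_cancel.mp h)

/-- At the origin, normality of a chain of sums of a regular sequence follows from normality
in the complement. -/
lemma normal_of_normal_punctured (f : Fin (n + 1) → MvPolynomial (Fin (n + 2)) K)
    (hreg : IsWeaklyRegular (MvPolynomial (Fin (n + 2)) K) (List.ofFn f))
    (hf : ∀ i, eval 0 (f i) = 0) (l : Fin n → K)
    (q : Ideal (MvPolynomial (Fin (n + 2)) K ⧸ Ideal.span (Set.range (consecutiveSums f l))))
    [q.IsPrime] (hq : q.comap (Ideal.Quotient.mk _) = vanishingIdeal K {(0 : Fin (n + 2) → K)})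
    (h : ∀ p : Ideal (MvPolynomial (Fin (n + 2)) K ⧸
      Ideal.span (Set.range (consecutiveSums f l))), ∀ [p.IsPrime], p ≠ q →
      IsDomain (Localization.AtPrime p) ∧ IsIntegrallyClosed (Localization.AtPrime p)) :
    IsDomain (Localization.AtPrime q) ∧ IsIntegrallyClosed (Localization.AtPrime q) := by
  let S := Localization.AtPrime (vanishingIdeal K {(0 : Fin (n + 2) → K)})
  have hX : IsRegular S (List.ofFn fun i => algebraMap (MvPolynomial (Fin (n + 2)) K) S (X i)) :=
    isRegular_localization_ofFn _ (ofFn_X_isWeaklyRegular K (n + 2)) 0 (by simp)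
  have hmem : ∀ p : MvPolynomial (Fin (n + 2)) K, eval 0 p = 0 →
      algebraMap (MvPolynomial (Fin (n + 2)) K) S p ∈ maximalIdeal S := by
    intro p hp
    rw [IsLocalization.AtPrime.to_map_mem_maximal_iff _
        (vanishingIdeal K {(0 : Fin (n + 2) → K)}), mem_vanishingIdeal_singleton_iff]
    exact hp
  have key := exists_regular_pair_quotient
    (isRegular_localization_consecutiveSums f hreg 0 hf l)
    (by
      intro r hr
      obtain ⟨i, rfl⟩ := (List.mem_ofFn' _ _).mp hr
      exact hmem _ (by rw [map_add, map_mul, hf, hf, mul_zero, add_zero]))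
    ⟨_, by rw [List.length_ofFn, List.length_ofFn, add_comm], by
      intro r hr
      obtain ⟨i, rfl⟩ := (List.mem_ofFn' _ _).mp hr
      exact hmem _ (by simp), hX⟩
  rw [ofList_localization_consecutiveSums] at key
  obtain ⟨a, ha, b, hb, hna, hnb⟩ := key
  let e := localizationQuotientEquiv _ q _ hq
  have hloc : IsLocalRing (S ⧸ (Ideal.span (Set.range (consecutiveSums f l))).map
      (algebraMap (MvPolynomial (Fin (n + 2)) K) S)) := e.isLocalRing
  have hmax : ∀ x ∈ maximalIdeal S, e.symm (Ideal.Quotient.mk _ x) ∈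
      maximalIdeal (Localization.AtPrime q) := by
    intro x hx
    rw [mem_maximalIdeal, mem_nonunits_iff, MulEquiv.isUnit_map, ← mem_nonunits_iff,
      ← mem_maximalIdeal]
    have h3 : (maximalIdeal (S ⧸ (Ideal.span (Set.range (consecutiveSums f l))).map
      (algebraMap (MvPolynomial (Fin (n + 2)) K) S))).comap (Ideal.Quotient.mk _) =
        maximalIdeal S :=
      eq_maximalIdeal (Ideal.comap_isMaximal_of_surjective _ Ideal.Quotient.mk_surjective)
    rw [← h3] at hx
    exact hx
  refine isDomain_and_isIntegrallyClosed_of_punctured (hmax a ha) (hmax b hb) ?_ ?_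
    (fun P hP => localization_localization_normal q h P)
  · rw [mem_nonZeroDivisors_iff_right] at hna ⊢
    intro x hx
    have := hna (e x) (by
      rw [← e.apply_symm_apply (Ideal.Quotient.mk _ a), ← map_mul, hx, map_zero])
    simpa using this
  · intro x hx
    rw [Ideal.mem_span_singleton] at hx ⊢
    obtain ⟨y, hy⟩ := hx
    have := hnb (e x) (by
      rw [Ideal.mem_span_singleton]
      refine ⟨e y, ?_⟩
      rw [← e.apply_symm_apply (Ideal.Quotient.mk _ a), ← map_mul, ← hy, map_mul,
        e.apply_symm_apply])
    obtain ⟨z, hz⟩ := Ideal.mem_span_singleton.mp this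
    refine ⟨e.symm z, ?_⟩
    rw [← map_mul, ← hz, e.symm_apply_apply]

end OriginDepth

section Derivations

open MvPolynomial

lemma derivation_aeval {K A σ : Type*} [Fintype σ] [CommRing K] [CommRing A] [Algebra K A]
    (D : Derivation K A A) (x : σ → A) (p : MvPolynomial σ K) :
    D (aeval x p) = ∑ j, aeval x (pderiv j p) * D (x j) := by
  classical
  induction p using MvPolynomial.induction_on with
  | C r => simp
  | add p q hp hq => simp [hp, hq, add_mul, Finset.sum_add_distrib]
  | mul_X p i hp =>
    simp [hp, pderiv_X, Pi.single_apply, add_mul, Finset.sum_add_distrib, Finset.mul_sum,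
      apply_ite (aeval x), mul_ite, ite_mul]
    refine Finset.sum_congr rfl fun j _ => ?_
    ring

lemma exists_ringHom_lift {T E B : Type*} [CommRing T] [CommRing E] [CommRing B] [Algebra T E]
    [Algebra.FormallySmooth T E] (φ : T →+* B) (π : B →+* E) (hπ : Function.Surjective π)
    (hker : IsNilpotent (RingHom.ker π)) (h : π.comp φ = algebraMap T E) :
    ∃ ψ : E →+* B, π.comp ψ = RingHom.id E ∧ ψ.comp (algebraMap T E) = φ := by
  algebraize [φ]
  let g : B →ₐ[T] E := { π with commutes' := fun r => RingHom.congr_fun h r }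
  refine ⟨(Algebra.FormallySmooth.liftOfSurjective (AlgHom.id T E) g hπ hker : E →ₐ[T] B), ?_, ?_⟩
  · ext x
    exact Algebra.FormallySmooth.liftOfSurjective_apply (AlgHom.id T E) g hπ hker x
  · ext x
    exact AlgHom.commutes _ x

lemma formallySmooth_of_injective {T E : Type*} [CommRing T] [IsDomain T] [CharZero T] [Field E]
    [Algebra T E] [FaithfulSMul T E] : Algebra.FormallySmooth T E := by
  let L := FractionRing T
  let : Algebra L E := FractionRing.liftAlgebra T E
  have : IsScalarTower T L E := FractionRing.isScalarTower_liftAlgebra T E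
  have : CharZero L := charZero_of_injective_algebraMap (IsFractionRing.injective T L)
  obtain ⟨ι, x, hx⟩ := exists_isTranscendenceBasis' L E
  have := hx.isAlgebraic_field
  have h1 : Algebra.FormallySmooth L E :=
    Algebra.FormallySmooth.of_algebraicIndependent_of_isSeparable hx.1
  have h2 : Algebra.FormallySmooth T L := .of_isLocalization (nonZeroDivisors T)
  exact .comp T L E

open TrivSqZeroExt in
/-- In characteristic zero, derivations may be prescribed on algebraically independent elements. -/
lemma exists_derivation_of_algebraicIndependent {K E ι : Type*} [Field K] [CharZero K] [Field E]
    [Algebra K E] {v : ι → E} (hv : AlgebraicIndependent K v) (d : ι → E) :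
    ∃ D : Derivation K E E, ∀ i, D (v i) = d i := by
  let : Algebra (MvPolynomial ι K) E := (aeval v).toAlgebra
  have : FaithfulSMul (MvPolynomial ι K) E := (faithfulSMul_iff_algebraMap_injective _ _).mpr hv
  have : Algebra.FormallySmooth (MvPolynomial ι K) E := formallySmooth_of_injective
  let φ : MvPolynomial ι K →+* TrivSqZeroExt E E := eval₂Hom ((inlHom E E).comp (algebraMap K E))
    fun i => inl (v i) + inr (d i)
  let π : TrivSqZeroExt E E →+* E := (fstHom E E E).toRingHom
  have hπ : ∀ x, π x = x.fst := fun x => rfl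
  have hker : IsNilpotent (RingHom.ker π) := by
    refine ⟨2, ?_⟩
    rw [pow_two (RingHom.ker π), Ideal.zero_eq_bot, eq_bot_iff, Ideal.mul_le]
    intro r hr s hs
    have hr' : r.fst = 0 := hr
    have hs' : s.fst = 0 := hs
    rw [Ideal.mem_bot]
    ext <;> simp [hr', hs']
  obtain ⟨ψ, h1, h2⟩ := exists_ringHom_lift φ π (fun x => ⟨inl x, rfl⟩) hker (by
    refine MvPolynomial.ringHom_ext (fun r => ?_) (fun i => ?_)
    · simp [φ, hπ, RingHom.algebraMap_toAlgebra, -DualNumber.inr_eq_smul_eps]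
    · simp [φ, hπ, RingHom.algebraMap_toAlgebra, -DualNumber.inr_eq_smul_eps])
  have hfst : ∀ x, (ψ x).fst = x := fun x => RingHom.congr_fun h1 x
  have hC : ∀ r : K, ψ (algebraMap K E r) = inl (algebraMap K E r) := by
    intro r
    have := RingHom.congr_fun h2 (C r)
    simpa [φ, RingHom.algebraMap_toAlgebra] using this
  refine ⟨Derivation.mk' ⟨⟨fun x => (ψ x).snd, fun x y => by simp⟩, fun r x => ?_⟩ ?_, fun i => ?_⟩
  · simp [Algebra.smul_def, hC]
  · intro a b
    simp [hfst, mul_comm]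
  · have := RingHom.congr_fun h2 (X i)
    simp only [RingHom.comp_apply, RingHom.algebraMap_toAlgebra, φ] at this
    have h3 : (ψ (v i)).snd = d i := by
      simpa [-DualNumber.inr_eq_smul_eps] using congrArg snd this
    exact h3

end Derivations

section Minors

lemma exists_det_submatrix_ne_zero {E σ : Type*} [Field E] [Fintype σ] {n : ℕ}
    (M : Matrix (Fin n) σ E) (hM : LinearIndependent E M.row) :
    ∃ s : Fin n → σ, (M.submatrix id s).det ≠ 0 := by
  obtain ⟨κ, a, -, hspan, hli⟩ := exists_linearIndependent' E M.col
  have h1 : Submodule.span E (Set.range M.col) = ⊤ := by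
    refine Submodule.eq_top_of_finrank_eq ?_
    rw [← Matrix.rank_eq_finrank_span_cols, hM.rank_matrix]
    simp
  let b := Module.Basis.mk hli (by rw [hspan, h1])
  let e := b.indexEquiv (Pi.basisFun E (Fin n))
  refine ⟨a ∘ e.symm, ?_⟩
  rw [← isUnit_iff_ne_zero, ← Matrix.isUnit_iff_isUnit_det,
    ← Matrix.linearIndependent_cols_iff_isUnit]
  exact hli.comp _ e.symm.injective

end Minors

section Generic

open MvPolynomial

variable {K σ : Type*} [Field K] {n : ℕ}

/-- The Jacobian matrix of the `f_i + l_i f_{i+1}` at an algebra-valued point `(x, l)`. -/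
noncomputable def jacobianAt (f : Fin (n + 1) → MvPolynomial σ K) {E : Type*} [CommRing E] [Algebra K E]
    (x : σ → E) (l : Fin n → E) : Matrix (Fin n) σ E :=
  Matrix.of fun i j =>
    aeval x (pderiv j (f i.castSucc)) + l i * aeval x (pderiv j (f i.succ))

lemma jacobianAt_map (f : Fin (n + 1) → MvPolynomial σ K) {E E' : Type*} [CommRing E]
    [Algebra K E] [CommRing E'] [Algebra K E'] (φ : E →ₐ[K] E') (x : σ → E) (l : Fin n → E) :
    (jacobianAt f x l).map φ = jacobianAt f (φ ∘ x) (φ ∘ l) := by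
  ext i j
  simp [jacobianAt, ← comp_aeval_apply, Function.comp_def]

lemma map_det_jacobianAt (f : Fin (n + 1) → MvPolynomial σ K) {E E' : Type*} [CommRing E]
    [Algebra K E] [CommRing E'] [Algebra K E'] (φ : E →ₐ[K] E') (x : σ → E) (l : Fin n → E)
    (s : Fin n → σ) : φ ((jacobianAt f x l).submatrix id s).det =
      ((jacobianAt f (φ ∘ x) (φ ∘ l)).submatrix id s).det := by
  rw [AlgHom.map_det, ← jacobianAt_map]
  rfl

lemma linearIndependent_jacobianAt_of_algebraicIndependent [Fintype σ] [CharZero K]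
    (f : Fin (n + 1) → MvPolynomial σ K) {E : Type*} [Field E] [Algebra K E] (x : σ → E)
    (l : Fin n → E) (hl : AlgebraicIndependent K l)
    (h0 : ∀ i : Fin n, aeval x (f i.castSucc) + l i * aeval x (f i.succ) = 0)
    (hf : ∀ i, aeval x (f i) ≠ 0) : LinearIndependent E (jacobianAt f x l).row := by
  rw [Fintype.linearIndependent_iff]
  intro c hc i
  obtain ⟨D, hD⟩ := exists_derivation_of_algebraicIndependent hl (Pi.single i 1)
  have h1 : ∀ i' : Fin n, ∑ j, jacobianAt f x l i' j * D (x j) =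
      - (aeval x (f i'.succ) * D (l i')) := by
    intro i'
    have h2 := congrArg D (h0 i')
    rw [map_add, D.leibniz, map_zero, derivation_aeval, derivation_aeval] at h2
    simp only [smul_eq_mul] at h2
    rw [eq_neg_iff_add_eq_zero, ← h2]
    simp only [jacobianAt, Matrix.of_apply, add_mul, Finset.sum_add_distrib, Finset.mul_sum,
      mul_assoc]
    ring
  have h3 : ∑ i', c i' * ∑ j, jacobianAt f x l i' j * D (x j) = 0 := by
    simp only [Finset.mul_sum]
    rw [Finset.sum_comm]
    refine Finset.sum_eq_zero fun j _ => ?_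
    have := congrFun hc j
    simp only [Finset.sum_apply, Pi.smul_apply, smul_eq_mul, Pi.zero_apply, Matrix.row] at this
    simp only [← mul_assoc]
    rw [← Finset.sum_mul, this, zero_mul]
  rw [Finset.sum_eq_single i] at h3
  · rw [h1, hD] at h3
    simpa [hf] using h3
  · intro b _ hb
    rw [h1, hD]
    simp [hb]
  · simp

/-- Generically in `l`, the Jacobian matrix of the `f_i + l_i f_{i+1}` has a nonzero
maximal minor at all points where no `f_i` vanishes. -/
lemma exists_minor_ne_zero_of_forall_ne_zero [Fintype σ] [CharZero K]
    (f : Fin (n + 1) → MvPolynomial σ K) :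
    ∃ q : MvPolynomial (Fin n) K, q ≠ 0 ∧ ∀ (x : σ → K) (l : Fin n → K), eval l q ≠ 0 →
      (∀ i : Fin n, eval x (f i.castSucc) + l i * eval x (f i.succ) = 0) →
      (∀ i, eval x (f i) ≠ 0) →
      ∃ s : Fin n → σ, ((jacobianAt f x l).submatrix id s).det ≠ 0 := by
  let x₀ : σ → MvPolynomial (Fin n ⊕ σ) K := fun j => X (Sum.inr j)
  let l₀ : Fin n → MvPolynomial (Fin n ⊕ σ) K := fun j => X (Sum.inl j)
  let I : Ideal (MvPolynomial (Fin n ⊕ σ) K) := Ideal.span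
    (Set.range (fun i : Fin n => aeval x₀ (f i.castSucc) + l₀ i * aeval x₀ (f i.succ)) ∪
      Set.range fun s : Fin n → σ => ((jacobianAt f x₀ l₀).submatrix id s).det)
  let F : MvPolynomial (Fin n ⊕ σ) K := ∏ i, aeval x₀ (f i)
  let M : Submonoid (MvPolynomial (Fin n ⊕ σ) K) := Submonoid.powers F ⊔
    (nonZeroDivisors (MvPolynomial (Fin n) K)).map
      (aeval l₀ : MvPolynomial (Fin n) K →ₐ[K] MvPolynomial (Fin n ⊕ σ) K)
  by_cases hdisj : Disjoint (I : Set (MvPolynomial (Fin n ⊕ σ) K)) (M : Set (MvPolynomial (Fin n ⊕ σ) K))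
  · exfalso
    obtain ⟨P, hP, hIP, hPM⟩ := Ideal.exists_le_prime_disjoint I M hdisj
    let E := FractionRing (MvPolynomial (Fin n ⊕ σ) K ⧸ P)
    let φ : MvPolynomial (Fin n ⊕ σ) K →ₐ[K] E :=
      (IsScalarTower.toAlgHom K (MvPolynomial (Fin n ⊕ σ) K ⧸ P) E).comp (Ideal.Quotient.mkₐ K P)
    have hφ : ∀ w, φ w = 0 ↔ w ∈ P := by
      intro w
      rw [← Ideal.Quotient.eq_zero_iff_mem]
      exact (IsFractionRing.injective (MvPolynomial (Fin n ⊕ σ) K ⧸ P) E).eq_iff' (map_zero _)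
    have hM : ∀ w ∈ M, φ w ≠ 0 := fun w hw h =>
      Set.disjoint_left.mp hPM ((hφ w).mp h) hw
    have hφx : ∀ p, aeval (φ ∘ x₀) p = φ (aeval x₀ p) := fun p =>
      (comp_aeval_apply x₀ φ p).symm
    have hφl : ∀ p, aeval (φ ∘ l₀) p = φ (aeval l₀ p) := fun p =>
      (comp_aeval_apply l₀ φ p).symm
    obtain ⟨s, hs⟩ := exists_det_submatrix_ne_zero _
      (linearIndependent_jacobianAt_of_algebraicIndependent f (φ ∘ x₀) (φ ∘ l₀) (by
        rw [AlgebraicIndependent, injective_iff_map_eq_zero]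
        intro p hp
        by_contra hp0
        rw [hφl] at hp
        exact hM _ (Submonoid.mem_sup_right
          ⟨p, mem_nonZeroDivisors_of_ne_zero hp0, rfl⟩) hp) (by
        intro i
        rw [hφx, hφx, Function.comp_apply, ← map_mul, ← map_add, hφ]
        exact hIP (Ideal.subset_span (Or.inl ⟨i, rfl⟩))) (by
        intro i hi
        rw [hφx] at hi
        refine hM F (Submonoid.mem_sup_left (Submonoid.mem_powers F)) ?_
        rw [map_prod]
        exact Finset.prod_eq_zero (Finset.mem_univ i) hi))
    refine hs ?_
    rw [← map_det_jacobianAt, hφ]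
    exact hIP (Ideal.subset_span (Or.inr ⟨s, rfl⟩))
  · obtain ⟨w, hwI, hwM⟩ := Set.not_disjoint_iff.mp hdisj
    obtain ⟨_, ⟨N, rfl⟩, _, ⟨q, hq, rfl⟩, rfl⟩ := Submonoid.mem_sup.mp hwM
    refine ⟨q, nonZeroDivisors.ne_zero hq, fun x l hql h0 hf => ?_⟩
    by_contra! hdet
    let φ : MvPolynomial (Fin n ⊕ σ) K →ₐ[K] K := aeval (Sum.elim l x)
    have hx₀ : φ ∘ x₀ = x := by ext; simp [φ, x₀]
    have hl₀ : φ ∘ l₀ = l := by ext; simp [φ, l₀]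
    have hφx : ∀ p, φ (aeval x₀ p) = eval x p := fun p => by
      rw [comp_aeval_apply x₀ φ p, show (fun i => φ (x₀ i)) = x from hx₀]; rfl
    have hφl : ∀ p, φ (aeval l₀ p) = eval l p := fun p => by
      rw [comp_aeval_apply l₀ φ p, show (fun i => φ (l₀ i)) = l from hl₀]; rfl
    have hI : I ≤ RingHom.ker φ := by
      refine Ideal.span_le.mpr ?_
      rintro _ (⟨i, rfl⟩ | ⟨s, rfl⟩)
      · have := h0 i
        rw [← hφx, ← hφx, ← congrFun hl₀ i, Function.comp_apply, ← map_mul, ← map_add] at this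
        exact this
      · have := hdet s
        rw [← hx₀, ← hl₀, ← map_det_jacobianAt] at this
        exact this
    have hw : φ (F ^ N * aeval l₀ q) = 0 := hI hwI
    rw [map_mul, map_pow, hφl, map_prod] at hw
    rcases mul_eq_zero.mp hw with h1 | h1
    · obtain ⟨i, -, hi⟩ := Finset.prod_eq_zero_iff.mp ((eq_zero_of_pow_eq_zero h1))
      exact hf i (by rw [← hφx, hi])
    · exact hql h1

end Generic

section Smoothness

open MvPolynomial

variable {K : Type*} [Field K] {n : ℕ}

lemma linearIndependent_add_mul_succ {V : Type*} [AddCommGroup V] [Module K V] {r : Fin (n + 1) → V}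
    (hr : LinearIndependent K r) (l : Fin n → K) :
    LinearIndependent K fun i : Fin n => r i.castSucc + l i • r i.succ := by
  rw [Fintype.linearIndependent_iff] at hr ⊢
  intro c hc
  let w : Fin (n + 1) → K := Fin.snoc (α := fun _ => K) c 0 +
    Fin.cons (α := fun _ => K) 0 fun i => c i * l i
  have hw : ∀ j, w j = 0 := by
    refine hr w ?_
    simp only [w, Pi.add_apply, add_smul, Finset.sum_add_distrib]
    rw [Fin.sum_univ_castSucc, Fin.sum_univ_succ (n := n) fun j =>
      Fin.cons (α := fun _ => K) 0 (fun i => c i * l i) j • r j]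
    simp only [Fin.snoc_castSucc, Fin.snoc_last, Fin.cons_zero, Fin.cons_succ, zero_smul, add_zero,
      zero_add, ← Finset.sum_add_distrib, mul_smul]
    simpa only [smul_add] using hc
  have key : ∀ k (hk : k < n), c ⟨k, hk⟩ = 0 := by
    intro k
    induction k with
    | zero =>
      intro hk
      have h := hw (Fin.castSucc ⟨0, hk⟩)
      simp only [w, Pi.add_apply, Fin.snoc_castSucc] at h
      rwa [show Fin.castSucc ⟨0, hk⟩ = 0 from rfl, Fin.cons_zero, add_zero] at h
    | succ k ih =>
      intro hk
      have h := hw (Fin.castSucc ⟨k + 1, hk⟩)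
      simp only [w, Pi.add_apply, Fin.snoc_castSucc] at h
      rwa [show Fin.castSucc ⟨k + 1, hk⟩ = Fin.succ ⟨k, by omega⟩ from rfl, Fin.cons_succ,
        ih (by omega), zero_mul, add_zero] at h
  exact fun i => key i i.2

lemma forall_eq_zero_of_add_mul_eq_zero {c : Fin (n + 1) → K} {l : Fin n → K} (hl : ∀ i, l i ≠ 0)
    (h : ∀ i : Fin n, c i.castSucc + l i * c i.succ = 0) {i : Fin (n + 1)} (hi : c i = 0)
    (j : Fin (n + 1)) : c j = 0 := by
  have hiff : ∀ i : Fin n, c i.castSucc = 0 ↔ c i.succ = 0 := by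
    intro i
    have := h i
    constructor
    · intro h0
      simpa [h0, hl] using this
    · intro h0
      simpa [h0] using this
  have h0 : ∀ j, c j = 0 ↔ c 0 = 0 := by
    intro j
    induction j using Fin.induction with
    | zero => rfl
    | succ j ih => rw [← hiff, ih]
  rw [h0, ← h0 i, hi]

/-- For generic `l`, the Jacobian criterion applies to the `f_i + l_i f_{i+1}` away from the
origin, provided it applies to the `f_i` there. -/
lemma exists_minor_ne_zero [CharZero K] (f : Fin (n + 1) → MvPolynomial (Fin (n + 2)) K)
    (hf : ∀ a : Fin (n + 2) → K, a ≠ 0 → (∀ i, eval a (f i) = 0) →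
      LinearIndependent K fun i j => eval a (pderiv j (f i))) :
    ∃ q : MvPolynomial (Fin n) K, q ≠ 0 ∧ ∀ l : Fin n → K, eval l q ≠ 0 → (∀ i, l i ≠ 0) →
      ∀ a : Fin (n + 2) → K, a ≠ 0 → (∀ i, eval a (consecutiveSums f l i) = 0) →
        ∃ s : Fin n → Fin (n + 2), ((jacobianAt f a l).submatrix id s).det ≠ 0 := by
  obtain ⟨q, hq, h⟩ := exists_minor_ne_zero_of_forall_ne_zero f
  refine ⟨q, hq, fun l hql hl a ha h0 => ?_⟩
  have h0' : ∀ i : Fin n, eval a (f i.castSucc) + l i * eval a (f i.succ) = 0 := fun i => by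
    simpa using h0 i
  by_cases hfa : ∀ i, eval a (f i) ≠ 0
  · exact h a l hql h0' hfa
  · push Not at hfa
    obtain ⟨i, hi⟩ := hfa
    exact exists_det_submatrix_ne_zero _ (linearIndependent_add_mul_succ
      (hf a ha (forall_eq_zero_of_add_mul_eq_zero hl h0' hi)) l)

lemma eval_det_pderiv (f : Fin (n + 1) → MvPolynomial (Fin (n + 2)) K) (l : Fin n → K)
    (a : Fin (n + 2) → K) (s : Fin n → Fin (n + 2)) :
    eval a (Matrix.of fun i j => pderiv (s i) (consecutiveSums f l j)).det =
      ((jacobianAt f a l).submatrix id s).det := by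
  rw [← Matrix.det_transpose (Matrix.submatrix _ _ _), RingHom.map_det]
  congr 1
  ext i j
  simp [jacobianAt, aeval_eq_eval]

/-- The Nullstellensatz for a prime ideal with at most one zero. -/
lemma comap_eq_vanishingIdeal [IsAlgClosed K] {m : ℕ} (p : Ideal (MvPolynomial (Fin m) K))
    [p.IsPrime] (a : Fin m → K) (h : ∀ b, (∀ r ∈ p, eval b r = 0) → b = a) :
    p = vanishingIdeal K {a} := by
  have hmax : (vanishingIdeal K {a}).IsMaximal := inferInstance
  refine ((hmax.eq_of_le (Ideal.IsPrime.ne_top ‹_›)) ?_).symm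
  rw [← IsJacobsonRing.out inferInstance (Ideal.IsPrime.isRadical ‹p.IsPrime›)]
  refine le_sInf ?_
  rintro M ⟨hpM, hM⟩
  obtain ⟨b, rfl⟩ := isMaximal_iff_eq_vanishingIdeal_singleton.mp hM
  rw [h b fun r hr => mem_vanishingIdeal_singleton_iff _ _ |>.mp (hpM hr)]

lemma isSmoothAt_consecutiveSums [IsAlgClosed K] (f : Fin (n + 1) → MvPolynomial (Fin (n + 2)) K)
    (l : Fin n → K) (h : ∀ a : Fin (n + 2) → K, a ≠ 0 → (∀ i, eval a (consecutiveSums f l i) = 0) →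
        ∃ s : Fin n → Fin (n + 2), ((jacobianAt f a l).submatrix id s).det ≠ 0)
    (q : Ideal (MvPolynomial (Fin (n + 2)) K ⧸ Ideal.span (Set.range (consecutiveSums f l))))
    [q.IsPrime] (hq : q.comap (Ideal.Quotient.mk _) ≠ vanishingIdeal K {(0 : Fin (n + 2) → K)}) :
    Algebra.IsSmoothAt K q ∧ q.height ≤ 2 := by
  obtain ⟨s, hs⟩ : ∃ s : Fin n → Fin (n + 2), Ideal.Quotient.mk _
      (Matrix.of fun i j => pderiv (s i) (consecutiveSums f l j)).det ∉ q := by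
    by_contra! hmin
    refine hq (comap_eq_vanishingIdeal _ 0 fun b hb => ?_)
    by_contra hb0
    obtain ⟨s, hs⟩ := h b hb0 fun i => hb _ (by
      have hmem : consecutiveSums f l i ∈ Ideal.span (Set.range (consecutiveSums f l)) :=
        Ideal.subset_span ⟨i, rfl⟩
      rw [Ideal.mem_comap, Ideal.Quotient.eq_zero_iff_mem.mpr hmem]
      exact zero_mem q)
    rw [← eval_det_pderiv] at hs
    exact hs (hb _ (hmin s))
  have := isSmoothAt_and_height_le (consecutiveSums f l) s q hs
  rwa [show n + 2 - n = 2 by omega] at this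

end Smoothness

section Dimension

lemma map_minimalPrime_eq_bot {A : Type*} [CommRing A] (P m : Ideal A) [m.IsPrime]
    (hP : P ∈ minimalPrimes A) (hPm : P ≤ m) [IsDomain (Localization.AtPrime m)] :
    P.map (algebraMap A (Localization.AtPrime m)) = ⊥ := by
  have hPp : P.IsPrime := hP.1.1
  have hker : RingHom.ker (algebraMap A (Localization.AtPrime m)) ≤ P := by
    intro x hx
    obtain ⟨s, hs⟩ := (IsLocalization.map_eq_zero_iff m.primeCompl _ x).mp hx
    exact (hPp.mem_or_mem (hs ▸ zero_mem P : (s : A) * x ∈ P)).resolve_left fun h => s.2 (hPm h)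
  have : P ≤ RingHom.ker (algebraMap A (Localization.AtPrime m)) :=
    hP.2 ⟨RingHom.ker_isPrime _, bot_le⟩ hker
  rw [Ideal.map_eq_bot_iff_le_ker]
  exact this

lemma ringKrullDim_eq_of_height_eq {A : Type*} [CommRing A] [Nontrivial A] (d : ℕ)
    (hht : ∀ m : Ideal A, m.IsMaximal → m.height = d) : ringKrullDim A = d := by
  refine le_antisymm
    ((ringKrullDim_le_iff_isMaximal_height_le _).mpr fun m hm => by rw [hht m hm]; rfl) ?_
  obtain ⟨m, hm⟩ := Ideal.exists_maximal A
  have h := Ideal.height_le_ringKrullDim_of_ne_top hm.ne_top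
  rw [hht m hm] at h
  exact h

lemma ringKrullDim_quotient_minimalPrime_eq {A : Type*} [CommRing A] (d : ℕ)
    (hdom : ∀ q : Ideal A, ∀ [q.IsPrime], IsDomain (Localization.AtPrime q))
    (hht : ∀ m : Ideal A, m.IsMaximal → m.height = d) (P : Ideal A) (hP : P ∈ minimalPrimes A) :
    ringKrullDim (A ⧸ P) = d := by
  have hPp : P.IsPrime := hP.1.1
  have : Nontrivial A := (Ideal.Quotient.mk P).domain_nontrivial
  refine le_antisymm ((ringKrullDim_quotient_le P).trans (ringKrullDim_eq_of_height_eq d hht).le) ?_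
  obtain ⟨q, hq⟩ := Ideal.exists_maximal (A ⧸ P)
  let m := q.comap (Ideal.Quotient.mk P)
  have hm : m.IsMaximal := Ideal.comap_isMaximal_of_surjective _ Ideal.Quotient.mk_surjective
  have hPm : P ≤ m := by
    intro x hx
    rw [Ideal.mem_comap, Ideal.Quotient.eq_zero_iff_mem.mpr hx]
    exact zero_mem q
  have := hdom m
  have h1 : ringKrullDim (Localization.AtPrime q) = ringKrullDim (Localization.AtPrime m) := by
    rw [ringKrullDim_eq_of_ringEquiv (localizationQuotientEquiv P q m rfl),
      map_minimalPrime_eq_bot P m hP hPm]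
    exact ringKrullDim_eq_of_ringEquiv (RingEquiv.quotientBot _)
  rw [IsLocalization.AtPrime.ringKrullDim_eq_height q,
    IsLocalization.AtPrime.ringKrullDim_eq_height m, hht m hm] at h1
  have h2 := Ideal.height_le_ringKrullDim_of_isPrime (I := q)
  rw [h1] at h2
  exact h2

open MvPolynomial in
lemma le_height_of_isMaximal {K : Type*} [Field K] {k d : ℕ}
    (h : Fin k → MvPolynomial (Fin (k + d)) K)
    (m : Ideal (MvPolynomial (Fin (k + d)) K ⧸ Ideal.span (Set.range h))) [hm : m.IsMaximal] :
    d ≤ m.height := by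
  let m' := m.comap (Ideal.Quotient.mk (Ideal.span (Set.range h)))
  have hm' : m'.IsMaximal := Ideal.comap_isMaximal_of_surjective _ Ideal.Quotient.mk_surjective
  have h1 := Ideal.height_le_height_add_encard_of_subset (Set.range h) (p := m') (by
    rintro _ ⟨i, rfl⟩
    have hmem : h i ∈ Ideal.span (Set.range h) := Ideal.subset_span ⟨i, rfl⟩
    change Ideal.Quotient.mk (Ideal.span (Set.range h)) (h i) ∈ m
    rw [Ideal.Quotient.eq_zero_iff_mem.mpr hmem]
    exact zero_mem m)
  rw [Ideal.map_comap_of_surjective _ Ideal.Quotient.mk_surjective,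
    height_eq_of_isMaximal K (k + d) m'] at h1
  have h2 : (Set.range h).encard ≤ k := by
    rw [← Set.image_univ]
    refine (Set.encard_image_le _ _).trans ?_
    simp
  have h3 := h1.trans (add_le_add_right h2 _)
  rw [Nat.cast_add, add_comm] at h3
  exact (ENat.add_le_add_iff_right (ENat.natCast_ne_top k)).mp h3

end Dimension

section Ring

open MvPolynomial

variable {K : Type*} [Field K] [IsAlgClosed K] {n : ℕ}

/-- The ring-theoretic properties of the coordinate ring of a surface `f_i + l_i f_{i+1} = 0`. -/
lemma normal_and_height_eq (f : Fin (n + 1) → MvPolynomial (Fin (n + 2)) K)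
    (hreg : RingTheory.Sequence.IsWeaklyRegular (MvPolynomial (Fin (n + 2)) K) (List.ofFn f))
    (hf : ∀ i, eval 0 (f i) = 0) (l : Fin n → K)
    (h : ∀ a : Fin (n + 2) → K, a ≠ 0 → (∀ i, eval a (consecutiveSums f l i) = 0) →
        ∃ s : Fin n → Fin (n + 2), ((jacobianAt f a l).submatrix id s).det ≠ 0) :
    (∀ q : Ideal (MvPolynomial (Fin (n + 2)) K ⧸ Ideal.span (Set.range (consecutiveSums f l))),
      ∀ [q.IsPrime], IsDomain (Localization.AtPrime q) ∧ IsIntegrallyClosed (Localization.AtPrime q)) ∧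
    (∀ q : Ideal (MvPolynomial (Fin (n + 2)) K ⧸ Ideal.span (Set.range (consecutiveSums f l))),
      q.IsMaximal → q.height = (2 : ℕ)) := by
  have : Algebra.FinitePresentation K
      (MvPolynomial (Fin (n + 2)) K ⧸ Ideal.span (Set.range (consecutiveSums f l))) :=
    Algebra.FinitePresentation.of_finiteType.mp inferInstance
  have hne : ∀ q : Ideal (MvPolynomial (Fin (n + 2)) K ⧸
      Ideal.span (Set.range (consecutiveSums f l))), ∀ [q.IsPrime],
      q.comap (Ideal.Quotient.mk _) ≠ vanishingIdeal K {(0 : Fin (n + 2) → K)} →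
      IsDomain (Localization.AtPrime q) ∧ IsIntegrallyClosed (Localization.AtPrime q) := by
    intro q _ hq
    have := (isSmoothAt_consecutiveSums f l h q hq).1
    exact isDomain_and_isIntegrallyClosed_of_isSmoothAt K q
  refine ⟨fun q _ => ?_, fun q hq => ?_⟩
  · by_cases hq0 : q.comap (Ideal.Quotient.mk _) = vanishingIdeal K {(0 : Fin (n + 2) → K)}
    · refine normal_of_normal_punctured f hreg hf l q hq0 fun p _ hp => hne p fun hp0 => hp ?_
      exact Ideal.comap_injective_of_surjective _ Ideal.Quotient.mk_surjective (hp0.trans hq0.symm)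
    · exact hne q hq0
  · by_cases hq0 : q.comap (Ideal.Quotient.mk _) = vanishingIdeal K {(0 : Fin (n + 2) → K)}
    · exact height_of_mem_base f hreg 0 hf l q hq0
    · exact le_antisymm (isSmoothAt_consecutiveSums f l h q hq0).2 (le_height_of_isMaximal _ q)

end Ring

section SchemeLayer

lemma mem_smoothLocus_structureMap_iff {m : ℕ} (I : Ideal (MvPolynomial (Fin m) ℂ))
    (x : PrimeSpectrum (MvPolynomial (Fin m) ℂ ⧸ I)) :
    (show affineSubscheme I from x) ∈ (structureMap I).smoothLocus ↔ Algebra.IsSmoothAt ℂ x.asIdeal := by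
  rw [Scheme.Hom.mem_smoothLocus]
  let q := x.asIdeal
  let p := q.comap (algebraMap ℂ (MvPolynomial (Fin m) ℂ ⧸ I))
  have : q.LiesOver p := ⟨rfl⟩
  let := Localization.AtPrime.algebraOfLiesOver p q
  trans Algebra.FormallySmooth (Localization.AtPrime p) (Localization.AtPrime q)
  · rw [← RingHom.formallySmooth_algebraMap]
    exact RingHom.FormallySmooth.respectsIso.arrow_mk_iso_iff
      (Scheme.arrowStalkMapSpecIso (CommRingCat.ofHom (algebraMap ℂ (MvPolynomial (Fin m) ℂ ⧸ I))) x)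
  · exact Algebra.FormallySmooth.iff_restrictScalars.symm

lemma isNormalScheme_affineSubscheme {m : ℕ} (I : Ideal (MvPolynomial (Fin m) ℂ))
    (h : ∀ q : Ideal (MvPolynomial (Fin m) ℂ ⧸ I), ∀ [q.IsPrime],
      IsDomain (Localization.AtPrime q) ∧ IsIntegrallyClosed (Localization.AtPrime q)) :
    IsNormalScheme (affineSubscheme I) := fun (x : PrimeSpectrum (MvPolynomial (Fin m) ℂ ⧸ I)) =>
  isDomain_and_isIntegrallyClosed_of_ringEquiv
    (Spec.stalkIso (CommRingCat.of (MvPolynomial (Fin m) ℂ ⧸ I)) x).symm.commRingCatIsoToRingEquiv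
    (h x.asIdeal)

lemma isReduced_of_isNormalScheme {X : Scheme.{0}} (h : IsNormalScheme X) : IsReduced X := by
  have : ∀ x : X, _root_.IsReduced (X.presheaf.stalk x) := fun x => by
    have := (h x).1
    infer_instance
  exact isReduced_of_isReduced_stalk X

lemma topologicalKrullDim_zeroLocus {A : Type*} [CommRing A] (P : Ideal A) :
    topologicalKrullDim (PrimeSpectrum.zeroLocus (P : Set A)) = ringKrullDim (A ⧸ P) := by
  rw [← PrimeSpectrum.topologicalKrullDim_eq_ringKrullDim]
  have h := PrimeSpectrum.isClosedEmbedding_comap_of_surjective _ _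
    (Ideal.Quotient.mk_surjective (I := P))
  have hr : Set.range (PrimeSpectrum.comap (Ideal.Quotient.mk P)) =
      PrimeSpectrum.zeroLocus (P : Set A) := by
    rw [range_comap_of_surjective _ _ Ideal.Quotient.mk_surjective, Ideal.mk_ker]
  rw [← hr]
  exact (IsHomeomorph.topologicalKrullDim_eq _ h.isEmbedding.toHomeomorph.isHomeomorph).symm

lemma isEquidimensional_affineSubscheme {m : ℕ} (I : Ideal (MvPolynomial (Fin m) ℂ)) (d : ℕ)
    (h : ∀ P ∈ minimalPrimes (MvPolynomial (Fin m) ℂ ⧸ I),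
      ringKrullDim ((MvPolynomial (Fin m) ℂ ⧸ I) ⧸ P) = d) :
    IsEquidimensional (affineSubscheme I) d := by
  intro Z hZ
  have hZ' : Z ∈ irreducibleComponents (PrimeSpectrum (MvPolynomial (Fin m) ℂ ⧸ I)) := hZ
  rw [← PrimeSpectrum.zeroLocus_minimalPrimes] at hZ'
  obtain ⟨P, hP, rfl⟩ := hZ'
  exact (topologicalKrullDim_zeroLocus P).trans (h P hP)

end SchemeLayer

section Main

open MvPolynomial

/-- The point of `V(I)` given by a common zero of `I`. -/
lemma exists_point_of_mem_zeroLocus {m : ℕ} (I : Ideal (MvPolynomial (Fin m) ℂ)) (a : Fin m → ℂ)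
    (ha : ∀ p ∈ I, eval a p = 0) : ∃ q : PrimeSpectrum (MvPolynomial (Fin m) ℂ ⧸ I),
      q.asIdeal.comap (Ideal.Quotient.mk I) = vanishingIdeal ℂ {a} := by
  have hle : I ≤ vanishingIdeal ℂ {a} := fun p hp =>
    (mem_vanishingIdeal_singleton_iff _ _).mpr (ha p hp)
  have h : pointToPoint a ∈ Set.range (PrimeSpectrum.comap (Ideal.Quotient.mk I)) := by
    rw [range_comap_of_surjective _ _ Ideal.Quotient.mk_surjective, Ideal.mk_ker]
    exact hle
  obtain ⟨q, hq⟩ := h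
  exact ⟨q, congrArg PrimeSpectrum.asIdeal hq⟩

lemma vanishingIdeal_singleton_injective {m : ℕ} {a b : Fin m → ℂ}
    (h : vanishingIdeal ℂ {a} = vanishingIdeal ℂ {b}) : a = b := by
  ext i
  have : (X i - C (b i) : MvPolynomial (Fin m) ℂ) ∈ vanishingIdeal ℂ {a} := by
    rw [h, mem_vanishingIdeal_singleton_iff]
    simp
  rw [mem_vanishingIdeal_singleton_iff] at this
  simpa [sub_eq_zero] using this

lemma eval_zero_of_origin_mem_singularLocus {m k : ℕ} {f : Fin k → MvPolynomial (Fin m) ℂ}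
    (h : origin m ∈ singularLocus (Ideal.span (Set.range f))) (i : Fin k) : eval 0 (f i) = 0 := by
  obtain ⟨x, -, hx⟩ := h
  have h1 : (f i) ∈ (origin m).asIdeal := by
    rw [← hx]
    change Ideal.Quotient.mk _ (f i) ∈ PrimeSpectrum.asIdeal x
    have hmem : f i ∈ Ideal.span (Set.range f) := Ideal.subset_span ⟨i, rfl⟩
    rw [Ideal.Quotient.eq_zero_iff_mem.mpr hmem]
    exact zero_mem _
  exact (mem_vanishingIdeal_singleton_iff _ _).mp h1

/-- The gradients of the equations of a complete intersection curve with at most one singular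
point, at the origin, are linearly independent elsewhere. -/
lemma linearIndependent_pderiv_of_singularLocus {g : ℕ} {f : Fin g → MvPolynomial (Fin (g + 1)) ℂ}
    (hreg : RingTheory.Sequence.IsWeaklyRegular (MvPolynomial (Fin (g + 1)) ℂ) (List.ofFn f))
    (h : singularLocus (Ideal.span (Set.range f)) ⊆ {origin (g + 1)}) (a : Fin (g + 1) → ℂ)
    (ha : a ≠ 0) (hf : ∀ i, eval a (f i) = 0) :
    LinearIndependent ℂ fun i j => eval a (pderiv j (f i)) := by
  have hle : Ideal.span (Set.range f) ≤ vanishingIdeal ℂ {a} := by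
    rw [Ideal.span_le]
    rintro _ ⟨i, rfl⟩
    exact (mem_vanishingIdeal_singleton_iff _ _).mpr (hf i)
  obtain ⟨q, hq⟩ := exists_point_of_mem_zeroLocus _ a fun p hp =>
    (mem_vanishingIdeal_singleton_iff _ _).mp (hle hp)
  have hsm : Algebra.IsSmoothAt ℂ q.asIdeal := by
    by_contra hns
    rw [← mem_smoothLocus_structureMap_iff] at hns
    have h1 := congrArg PrimeSpectrum.asIdeal (Set.mem_singleton_iff.mp (h ⟨q, hns, rfl⟩))
    have h2 : vanishingIdeal ℂ {a} = vanishingIdeal ℂ {(0 : Fin (g + 1) → ℂ)} := hq.symm.trans h1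
    exact ha (vanishingIdeal_singleton_injective h2)
  exact linearIndependent_pderiv_of_isSmoothAt f hreg a hf q.asIdeal hq

lemma singularLocus_subset_origin {m : ℕ} (I : Ideal (MvPolynomial (Fin m) ℂ))
    (h : ∀ q : Ideal (MvPolynomial (Fin m) ℂ ⧸ I), ∀ [q.IsPrime],
      q.comap (Ideal.Quotient.mk _) ≠ vanishingIdeal ℂ {(0 : Fin m → ℂ)} →
      Algebra.IsSmoothAt ℂ q) :
    singularLocus I ⊆ {origin m} := by
  rintro _ ⟨(x : PrimeSpectrum (MvPolynomial (Fin m) ℂ ⧸ I)), hx, rfl⟩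
  by_contra hne
  refine hx ((mem_smoothLocus_structureMap_iff I x).mpr (h x.asIdeal fun h0 => hne ?_))
  exact PrimeSpectrum.ext h0

lemma isComplexSurface_structureMap {m : ℕ} (I : Ideal (MvPolynomial (Fin m) ℂ))
    (hred : IsReduced (affineSubscheme I)) (hdim : ringKrullDim (MvPolynomial (Fin m) ℂ ⧸ I) = 2) :
    IsComplexSurface (structureMap I) where
  reduced := hred
  separated := inferInstance
  locallyOfFiniteType := inferInstance
  quasiCompact := inferInstance
  dim_eq_two := (PrimeSpectrum.topologicalKrullDim_eq_ringKrullDim _).trans hdim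

/-- The conclusion for those `l` that satisfy the Jacobian criterion away from the origin. -/
lemma surface_properties {n : ℕ} (f : Fin (n + 1) → MvPolynomial (Fin (n + 2)) ℂ)
    (hreg : RingTheory.Sequence.IsWeaklyRegular (MvPolynomial (Fin (n + 2)) ℂ) (List.ofFn f))
    (hf : ∀ i, eval 0 (f i) = 0) (l : Fin n → ℂ)
    (h : ∀ a : Fin (n + 2) → ℂ, a ≠ 0 → (∀ i, eval a (consecutiveSums f l i) = 0) →
        ∃ s : Fin n → Fin (n + 2), ((jacobianAt f a l).submatrix id s).det ≠ 0) :
    IsComplexSurface (structureMap (Ideal.span (Set.range (consecutiveSums f l)))) ∧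
      IsEquidimensional (affineSubscheme (Ideal.span (Set.range (consecutiveSums f l)))) 2 ∧
      IsNormalScheme (affineSubscheme (Ideal.span (Set.range (consecutiveSums f l)))) ∧
      singularLocus (Ideal.span (Set.range (consecutiveSums f l))) ⊆ {origin (n + 2)} := by
  obtain ⟨hnormal, hheight⟩ := normal_and_height_eq f hreg hf l h
  have hN := isNormalScheme_affineSubscheme _ hnormal
  have hle : Ideal.span (Set.range (consecutiveSums f l)) ≤
      vanishingIdeal ℂ {(0 : Fin (n + 2) → ℂ)} := by
    rw [Ideal.span_le]
    rintro _ ⟨i, rfl⟩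
    refine (mem_vanishingIdeal_singleton_iff _ _).mpr ?_
    change eval 0 _ = 0
    rw [map_add, map_mul, hf, hf, mul_zero, add_zero]
  obtain ⟨x, -⟩ := exists_point_of_mem_zeroLocus _ 0 fun p hp =>
    (mem_vanishingIdeal_singleton_iff _ _).mp (hle hp)
  have := x.nontrivial
  exact ⟨isComplexSurface_structureMap _ (isReduced_of_isNormalScheme hN)
      (ringKrullDim_eq_of_height_eq 2 hheight),
    isEquidimensional_affineSubscheme _ 2
      (ringKrullDim_quotient_minimalPrime_eq 2 (fun q _ => (hnormal q).1) hheight), hN,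
    singularLocus_subset_origin _ fun q _ hq => (isSmoothAt_consecutiveSums f l h q hq).1⟩

lemma forGenericTorusPoint_of_eval_ne_zero {k : ℕ} {P : (Fin k → ℂ) → Prop}
    {q : MvPolynomial (Fin k) ℂ} (hq : q ≠ 0)
    (h : ∀ l : Fin k → ℂ, eval l q ≠ 0 → (∀ i, l i ≠ 0) → P l) : ForGenericTorusPoint k P := by
  have hmem : ∀ l : Fin k → ℂ, l ∉ zeroLocus ℂ (Ideal.span {q}) ↔ eval l q ≠ 0 := by
    intro l
    rw [zeroLocus_span]
    simp [aeval_eq_eval]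
  refine ⟨Ideal.span {q}, ?_, fun l hl hlq => h l ((hmem l).mp hlq) hl⟩
  have hne : q * ∏ i, X i ≠ 0 :=
    mul_ne_zero hq (Finset.prod_ne_zero_iff.mpr fun i _ => X_ne_zero i)
  obtain ⟨l, hl⟩ : ∃ l, eval l (q * ∏ i, X i) ≠ 0 := by
    by_contra! h0
    exact hne (MvPolynomial.funext fun l => by rw [h0, map_zero])
  rw [map_mul, map_prod, mul_ne_zero_iff, Finset.prod_ne_zero_iff] at hl
  exact ⟨l, fun i => by simpa using hl.2 i (Finset.mem_univ i), (hmem l).mpr hl.1⟩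

end Main

end GenericSurface

open GenericSurface in
theorem mainTheorem9 (g : ℕ) (hg : 2 ≤ g)
    (f : Fin g → MvPolynomial (Fin (g + 1)) ℂ)
    (hreg : RingTheory.Sequence.IsRegular (MvPolynomial (Fin (g + 1)) ℂ) (List.ofFn f))
    (hsing : singularLocus (Ideal.span (Set.range f)) = {origin (g + 1)}) :
    ForGenericTorusPoint (g - 1) fun lam =>
      IsComplexSurface (structureMap (surfaceIdeal f lam)) ∧
      IsEquidimensional (affineSubscheme (surfaceIdeal f lam)) 2 ∧
      IsNormalScheme (affineSubscheme (surfaceIdeal f lam)) ∧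
      singularLocus (surfaceIdeal f lam) ⊆ {origin (g + 1)} := by
  obtain ⟨n, rfl⟩ : ∃ n, g = n + 1 := ⟨g - 1, by omega⟩
  have hf0 := eval_zero_of_origin_mem_singularLocus (hsing.ge rfl)
  obtain ⟨q, hq, hmin⟩ := exists_minor_ne_zero f
    (linearIndependent_pderiv_of_singularLocus hreg.toIsWeaklyRegular hsing.le)
  refine forGenericTorusPoint_of_eval_ne_zero (k := n) hq fun l hql hl => ?_
  exact surface_properties f hreg.toIsWeaklyRegular hf0 l (hmin l hql hl)
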